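/- Let $V=(V,Y,\mathbf 1,\omega)$ be a vertex operator superalgebra over $\mathbb C$: $V=\bigoplus_{n\in\frac12\mathbb Z_{\ge 0}}V_n$ with $V_{\bar 0}=\bigoplus_{n\in\mathbb Z}V_n$, $V_{\bar 1}=\bigoplus_{n\in\frac12+\mathbb Z}V_n$, $\dim V_n<\infty$, with the usual truncation, vacuum, creation, Virasoro, $L(-1)$-derivative, $L(0)$-grading and super Jacobi axioms. Let $\sigma$ be the automorphism equal to $1$ on $V_{\bar 0}$ and $-1$ on $V_{\bar 1}$, let $g$ be an automorphism of $V$ of finite order $T_0$, let $T$ be the order of $g\sigma$, and put $V^{r}=\{v: gv=e^{2\pi i r/T_0}v\}$, $V^{r*}=\{v: g\sigma v=e^{2\pi i r/T}v\}$. For homogeneous $u\in V^{r*}$ ($0\le r<T$) and $v\in V$, with $\delta_r=1$ if $r=0$ and $\delta_r=0$ otherwise, put $$u\circ_g v=\mathrm{Res}_z\frac{(1+z)^{\mathrm{wt}\,u-1+\delta_r+r/T}}{z^{1+\delta_r}}Y(u,z)v,$$ $$u*_g v=\mathrm{Res}_z\frac{(1+z)^{\mathrm{wt}\,u}}{z}Y(u,z)v\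 \text{ if } r=0,\qquad u*_gv=0\ \text{ if } r>0,$$ extend $*_g$ bilinearly to $V$, let $O_g(V)$ be the linear span of all $u\circ_g v$, and let $A_g(V)=V/O_g(V)$. A weak $g$-twisted $V$-module is a complex vector space $M$ with a linear map $v\mapsto Y_M(v,z)=\sum_{n\in\frac1{T_0}\mathbb Z}v_nz^{-n-1}$, $v_n\in\mathrm{End}\,M$, such that for $0\le r<T_0$, $u\in V^r$, $v\in V$, $w\in M$: $u_n=0$ unless $n\in\frac r{T_0}+\mathbb Z$; $u_nw=0$ for $n\gg0$; $Y_M(\mathbf 1,z)=\mathrm{Id}_M$; and the twisted super Jacobi identity holds, $$z_0^{-1}\delta\!\left(\tfrac{z_1-z_2}{z_0}\right)Y_M(u,z_1)Y_M(v,z_2)-(-1)^{\tilde u\tilde v}z_0^{-1}\delta\!\left(\tfrac{z_2-z_1}{-z_0}\right)Y_M(v,z_2)Y_M(u,z_1)=z_2^{-1}\left(\tfrac{z_1-z_0}{z_2}\right)^{-r/T_0}\delta\!\left(\tfrac{z_1-z_0}{z_2}\right)Y_M(Y(u,z_0)v,z_2)$$ for $u,v$ homogeneous with parities $\tilde u,\tilde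 v$. Morphisms are linear maps commuting with all $v_n$. Let $$\Omega(M)=\{w\in M:\ u_{m}w=0\ \text{for all homogeneous } u\in V \text{ and all } m\in\tfrac1{T_0}\mathbb Z \text{ with } m>\mathrm{wt}\,u-1\}$$ be the space of lowest weight vectors, and let $o(a)=a_{\mathrm{wt}\,a-1}$ for homogeneous $a\in V$ (read as $0$ if $\mathrm{wt}\,a-1\notin\frac1{T_0}\mathbb Z$), extended linearly to $V$. **Theorem 5.1.** The product $*_g$ induces on $A_g(V)$ the structure of an associative algebra with unit $\mathbf 1+O_g(V)$, and for every weak $g$-twisted $V$-module $M$ the operators $o(a)$ preserve $\Omega(M)$ and $a+O_g(V)\mapsto o(a)|_{\Omega(M)}$ is a well-defined unital representation of the associative algebra $A_g(V)$ on $\Omega(M)$. Moreover $M\mapsto\Omega(M)$, $f\mapsto f|_{\Omega(M)}$ is a functor from the category of weak $g$-twisted $V$-modules to the category of $A_g(V)$-modules. -/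

import Mathlib

universe u w

noncomputable section

/-- A vertex operator superalgebra structure on the complex vector space `V`.
* `gr k` is the weight space `V_{k/2}`; its vectors have weight `k/2` and parity `k mod 2`.
* `Y v n` is the mode `v_n`, so `Y(v,z) = ∑ₙ v_n z^{-n-1}`.
* `L(m) = ω_{m+1}`, i.e. `L m = Y conf (m + 1)`. -/
structure VertexOperatorSuperalgebra (V : Type u) [AddCommGroup V] [Module ℂ V] where
  gr : ℕ → Submodule ℂ V
  isInternal : DirectSum.IsInternal gr
  finiteDimensional : ∀ k, FiniteDimensional ℂ (gr k)
  Y : V →ₗ[ℂ] (ℤ → Module.End ℂ V)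
  vac : V
  conf : V
  vac_mem : vac ∈ gr 0
  conf_mem : conf ∈ gr 4
  truncation : ∀ u v : V, ∃ N : ℤ, ∀ n : ℤ, N ≤ n → Y u n v = 0
  vac_mode : ∀ n : ℤ, Y vac n = if n = -1 then 1 else 0
  creation : ∀ (v : V) (n : ℤ), 0 ≤ n → Y v n vac = 0
  creation_limit : ∀ v : V, Y v (-1) vac = v
  virasoro : ∃ c : ℂ, ∀ m n : ℤ,
    Y conf (m + 1) * Y conf (n + 1) - Y conf (n + 1) * Y conf (m + 1) =
      ((m : ℂ) - n) • Y conf (m + n + 1) +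
        (if m + n = 0 then (((m : ℂ) ^ 3 - m) / 12 * c) • (1 : Module.End ℂ V) else 0)
  /-- `d/dz Y(v,z) = Y(L(-1)v,z)`. -/
  derivation : ∀ (v : V) (n : ℤ), Y (Y conf 0 v) n = (-(n : ℂ)) • Y v (n - 1)
  /-- `L(0)` acts on `V_{k/2}` as `k/2`. -/
  weight : ∀ (k : ℕ), ∀ v ∈ gr k, Y conf 1 v = ((k : ℂ) / 2) • v
  /-- The coefficient of `z₀^{-p-1} z₁^{-m-1} z₂^{-n-1}` in the super Jacobi identity, applied to a
  vector `x`. By `truncation`, all sums over `i` have only finitely many nonzero terms. -/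
  jacobi : ∀ (k l : ℕ), ∀ u ∈ gr k, ∀ v ∈ gr l, ∀ (x : V) (p m n : ℤ),
    ∑ᶠ i : ℕ, ((-1 : ℂ) ^ i * Ring.choose (p : ℂ) i) •
        (Y u (m + p - i) (Y v (n + i) x) -
          ((-1 : ℂ) ^ p * (-1 : ℂ) ^ (k * l)) • Y v (n + p - i) (Y u (m + i) x)) =
      ∑ᶠ i : ℕ, (Ring.choose (m : ℂ) i) • Y (Y u (p + i) v) (m + n - i) x

namespace VertexOperatorSuperalgebra

variable {V : Type u} [AddCommGroup V] [Module ℂ V] (A : VertexOperatorSuperalgebra V)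

/-- The isomorphism of `⨁ₖ V_{k/2}` with `V`. -/
def grEquiv : (DirectSum ℕ fun k => A.gr k) ≃ₗ[ℂ] V :=
  LinearEquiv.ofBijective (DirectSum.coeLinearMap A.gr)
    (show Function.Bijective (DirectSum.coeLinearMap A.gr) from A.isInternal)

theorem grEquiv_symm_of_mem {k : ℕ} {v : V} (hv : v ∈ A.gr k) :
    A.grEquiv.symm v = DirectSum.lof ℂ ℕ (fun k => A.gr k) k ⟨v, hv⟩ := by
  rw [LinearEquiv.symm_apply_eq]
  exact (DirectSum.coeLinearMap_lof A.gr k ⟨v, hv⟩).symm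

/-- The linear map on `V = ⨁ₖ V_{k/2}` which restricts to `f k` on `V_{k/2}`. -/
def gradedLift {W : Type*} [AddCommGroup W] [Module ℂ W] (f : ℕ → (V →ₗ[ℂ] W)) : V →ₗ[ℂ] W :=
  (DirectSum.toModule ℂ ℕ W fun k => (f k).comp (A.gr k).subtype).comp
    A.grEquiv.symm.toLinearMap

theorem gradedLift_of_mem {W : Type*} [AddCommGroup W] [Module ℂ W] (f : ℕ → (V →ₗ[ℂ] W))
    {k : ℕ} {v : V} (hv : v ∈ A.gr k) : A.gradedLift f v = f k v := by
  simp [gradedLift, A.grEquiv_symm_of_mem hv]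

/-- Two linear maps on `V` agreeing on all weight spaces are equal. -/
theorem hom_ext_gr {W : Type*} [AddCommGroup W] [Module ℂ W] {f f' : V →ₗ[ℂ] W}
    (h : ∀ k, ∀ v ∈ A.gr k, f v = f' v) : f = f' := by
  ext v
  have hv : v ∈ ⨆ k, A.gr k := by
    rw [A.isInternal.submodule_iSup_eq_top]; trivial
  induction hv using Submodule.iSup_induction' with
  | mem k x hx => exact h k x hx
  | zero => simp
  | add x y _ _ hx hy => simp [hx, hy]

/-- The canonical involution as a linear map: `1` on even vectors and `-1` on odd vectors. -/
def parityMap : V →ₗ[ℂ] V := A.gradedLift fun k => (-1 : ℂ) ^ k • LinearMap.id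

theorem parityMap_of_mem {k : ℕ} {v : V} (hv : v ∈ A.gr k) :
    A.parityMap v = (-1 : ℂ) ^ k • v := by
  simp [parityMap, A.gradedLift_of_mem _ hv]

theorem parityMap_involutive : Function.Involutive A.parityMap := by
  have h : A.parityMap.comp A.parityMap = LinearMap.id := by
    apply A.hom_ext_gr
    intro k v hv
    simp [A.parityMap_of_mem hv, smul_smul, ← mul_pow]
  intro v
  exact LinearMap.congr_fun h v

/-- The canonical automorphism `σ`: `1` on even vectors and `-1` on odd vectors. -/
def sigma : V ≃ₗ[ℂ] V := LinearEquiv.ofInvolutive A.parityMap A.parityMap_involutive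

/-- A linear automorphism `g` of `V` is an automorphism of the vertex operator superalgebra if it
fixes `ω` and `g Y(v,z) g⁻¹ = Y(g v,z)`. -/
def IsAutomorphism (g : V ≃ₗ[ℂ] V) : Prop :=
  g A.conf = A.conf ∧ ∀ (v : V) (n : ℤ) (x : V), g (A.Y v n x) = A.Y (g v) n (g x)

/-- `V^r`: the eigenspace of `g` with eigenvalue `exp(2πi r/T₀)`, `T₀` the order of `g`. -/
def eig (g : V ≃ₗ[ℂ] V) (r : ℕ) : Submodule ℂ V :=
  Module.End.eigenspace (g : V →ₗ[ℂ] V)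
    (Complex.exp (2 * Real.pi * Complex.I * r / orderOf g))

/-- `T`: the order of `gσ`. -/
def ordT (g : V ≃ₗ[ℂ] V) : ℕ := orderOf (g * A.sigma)

/-- `V^{r*}`: the eigenspace of `gσ` with eigenvalue `exp(2πi r/T)`. -/
def eigStar (g : V ≃ₗ[ℂ] V) (r : ℕ) : Submodule ℂ V :=
  Module.End.eigenspace ((g * A.sigma : V ≃ₗ[ℂ] V) : V →ₗ[ℂ] V)
    (Complex.exp (2 * Real.pi * Complex.I * r / A.ordT g))

theorem finite_support_mode (c : ℕ → ℂ) (m : ℤ) (u v : V) :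
    (Function.support fun i : ℕ => c i • A.Y u (i - m) v).Finite := by
  obtain ⟨N, hN⟩ := A.truncation u v
  refine (Set.finite_lt_nat (N + m).toNat).subset fun i hi => ?_
  by_contra h
  apply hi
  rw [Set.mem_ofPred_eq, not_lt] at h
  simp only
  rw [hN _ (by omega), smul_zero]

/-- `Res_z (1+z)^α z^{-m} Y(u,z)v = ∑_{i ≥ 0} (α choose i) u_{i-m} v`, a finite sum by truncation,
as a bilinear map in `u` and `v`. -/
def resProd (α : ℂ) (m : ℤ) : V →ₗ[ℂ] V →ₗ[ℂ] V :=
  LinearMap.mk₂ ℂ (fun u v => ∑ᶠ i : ℕ, Ring.choose α i • A.Y u (i - m) v)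
    (fun u u' v => by
      rw [← finsum_add_distrib (A.finite_support_mode _ m u v) (A.finite_support_mode _ m u' v)]
      simp)
    (fun c u v => by
      rw [smul_finsum' c (A.finite_support_mode _ m u v)]
      simp [smul_comm c])
    (fun u v v' => by
      rw [← finsum_add_distrib (A.finite_support_mode _ m u v) (A.finite_support_mode _ m u v')]
      simp)
    (fun c u v => by
      rw [smul_finsum' c (A.finite_support_mode _ m u v)]
      simp [smul_comm c])

/-- `δ_r`: equal to `1` if `r = 0` and to `0` otherwise. -/
def delta (r : ℕ) : ℕ := if r = 0 then 1 else 0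

/-- `O_g(V)`: the linear span of all
`u ∘_g v = Res_z (1+z)^{wt u - 1 + δ_r + r/T} z^{-1-δ_r} Y(u,z)v`
with `u ∈ V^{r*}` homogeneous, `0 ≤ r < T`, and `v ∈ V`. -/
def Og (g : V ≃ₗ[ℂ] V) : Submodule ℂ V :=
  Submodule.span ℂ {x : V | ∃ k r : ℕ, r < A.ordT g ∧ ∃ u ∈ A.gr k ⊓ A.eigStar g r, ∃ v : V,
    x = A.resProd ((k : ℂ) / 2 - 1 + delta r + (r : ℂ) / A.ordT g) (1 + delta r) u v}

/-- The projection `T⁻¹ ∑_{j<T} (gσ)^j` of `V` onto `V^{0*}` along `⨁_{0<r<T} V^{r*}`. -/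
def fixedProj (g : V ≃ₗ[ℂ] V) : V →ₗ[ℂ] V :=
  (A.ordT g : ℂ)⁻¹ •
    ∑ j ∈ Finset.range (A.ordT g), ((g * A.sigma : V ≃ₗ[ℂ] V) : V →ₗ[ℂ] V) ^ j

/-- The bilinear product `*_g` on `V`: see `star_of_mem_zero` and `star_of_mem_pos`. -/
def star (g : V ≃ₗ[ℂ] V) : V →ₗ[ℂ] V →ₗ[ℂ] V :=
  A.gradedLift fun k => (A.resProd ((k : ℂ) / 2) 1).comp (A.fixedProj g)

theorem pow_apply_of_mem_eigStar {g : V ≃ₗ[ℂ] V} {r : ℕ} {u : V} (hu : u ∈ A.eigStar g r)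
    (j : ℕ) : (((g * A.sigma : V ≃ₗ[ℂ] V) : V →ₗ[ℂ] V) ^ j) u =
      Complex.exp (2 * Real.pi * Complex.I * r / A.ordT g) ^ j • u := by
  rw [eigStar, Module.End.mem_eigenspace_iff] at hu
  induction j with
  | zero => simp
  | succ j ih => rw [pow_succ', Module.End.mul_apply, ih, map_smul, hu, smul_smul, pow_succ]

/-- `u *_g v = Res_z (1+z)^{wt u} z^{-1} Y(u,z)v` for homogeneous `u ∈ V^{0*}`. -/
theorem star_of_mem_zero {g : V ≃ₗ[ℂ] V} (hT : 0 < A.ordT g) {k : ℕ} {u : V}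
    (hk : u ∈ A.gr k) (hu : u ∈ A.eigStar g 0) (v : V) :
    A.star g u v = ∑ᶠ i : ℕ, Ring.choose ((k : ℂ) / 2) i • A.Y u (i - 1) v := by
  have h : A.fixedProj g u = u := by
    have hT' : (A.ordT g : ℂ) ≠ 0 := by exact_mod_cast hT.ne'
    simp only [fixedProj, LinearMap.smul_apply, LinearMap.sum_apply,
      A.pow_apply_of_mem_eigStar hu]
    simp [← Nat.cast_smul_eq_nsmul ℂ, smul_smul, hT']
  rw [star, A.gradedLift_of_mem _ hk, LinearMap.comp_apply, h]
  rfl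

/-- `u *_g v = 0` for homogeneous `u ∈ V^{r*}` with `0 < r < T`. -/
theorem star_of_mem_pos {g : V ≃ₗ[ℂ] V} {k r : ℕ} (hr : 0 < r) (hrT : r < A.ordT g) {u : V}
    (hk : u ∈ A.gr k) (hu : u ∈ A.eigStar g r) (v : V) : A.star g u v = 0 := by
  have hT : A.ordT g ≠ 0 := by omega
  have hprim := Complex.isPrimitiveRoot_exp (A.ordT g) hT
  set ζ : ℂ := Complex.exp (2 * Real.pi * Complex.I * r / A.ordT g) with hζ
  have hpow : ζ = Complex.exp (2 * Real.pi * Complex.I / A.ordT g) ^ r := by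
    rw [hζ, ← Complex.exp_nat_mul]
    congr 1
    ring
  have h1 : ζ ≠ 1 := by
    rw [hpow]
    exact hprim.pow_ne_one_of_pos_of_lt hr.ne' hrT
  have hT1 : ζ ^ A.ordT g = 1 := by
    rw [hpow, pow_right_comm, hprim.pow_eq_one, one_pow]
  have hsum : ∑ j ∈ Finset.range (A.ordT g), ζ ^ j = 0 := by
    rw [geom_sum_eq h1, hT1, sub_self, zero_div]
  have h : A.fixedProj g u = 0 := by
    simp only [fixedProj, LinearMap.smul_apply, LinearMap.sum_apply,
      A.pow_apply_of_mem_eigStar hu, ← Finset.sum_smul]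
    rw [hsum, zero_smul, smul_zero]
  rw [star, A.gradedLift_of_mem _ hk, LinearMap.comp_apply, h]
  simp

/-- The product `*_g` induces on `V ⧸ O_g(V)` a well-defined associative product with unit
`1 + O_g(V)`. -/
structure InducesAlgebra (g : V ≃ₗ[ℂ] V) : Prop where
  star_mem_left : ∀ u ∈ A.Og g, ∀ v : V, A.star g u v ∈ A.Og g
  star_mem_right : ∀ u : V, ∀ v ∈ A.Og g, A.star g u v ∈ A.Og g
  assoc : ∀ u v x : V, A.star g (A.star g u v) x - A.star g u (A.star g v x) ∈ A.Og g
  one_star : ∀ v : V, A.star g A.vac v - v ∈ A.Og g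
  star_one : ∀ v : V, A.star g v A.vac - v ∈ A.Og g

variable {A}

/-- The algebra `A_g(V)`: the quotient space `V ⧸ O_g(V)` with the product induced by `*_g`. -/
def Ag {g : V ≃ₗ[ℂ] V} (_h : A.InducesAlgebra g) : Type u := V ⧸ A.Og g

namespace Ag

variable {g : V ≃ₗ[ℂ] V} (h : A.InducesAlgebra g)

instance : AddCommGroup (Ag h) := inferInstanceAs (AddCommGroup (V ⧸ A.Og g))

instance : Module ℂ (Ag h) := inferInstanceAs (Module ℂ (V ⧸ A.Og g))

/-- The class `a + O_g(V)`. -/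
def mk : V →ₗ[ℂ] Ag h := (A.Og g).mkQ

theorem mk_surjective : Function.Surjective (mk h) := (A.Og g).mkQ_surjective

theorem mk_eq_mk_iff {u v : V} : mk h u = mk h v ↔ u - v ∈ A.Og g :=
  Submodule.Quotient.eq (A.Og g)

/-- The induced product, as a bilinear map. -/
def mulMap : Ag h →ₗ[ℂ] Ag h →ₗ[ℂ] Ag h :=
  (A.Og g).liftQ
    (LinearMap.mk₂ ℂ
      (fun u (x : Ag h) => (A.Og g).liftQ ((mk h).comp (A.star g u)) (fun v hv => by
        have := h.star_mem_right u v hv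
        rw [LinearMap.mem_ker, LinearMap.comp_apply]
        exact (Submodule.Quotient.mk_eq_zero _).2 this) x)
      (fun u u' x => by obtain ⟨v, rfl⟩ := mk_surjective h x; exact (congrArg (mk h) (LinearMap.map_add₂ (A.star g) u u' v)).trans (map_add (mk h) _ _))
      (fun c u x => by obtain ⟨v, rfl⟩ := mk_surjective h x; exact (congrArg (mk h) (LinearMap.map_smul₂ (A.star g) c u v)).trans (map_smul (mk h) _ _))
      (fun u x x' => map_add _ x x')
      (fun c u x => map_smul _ c x))
    (fun u hu => by
      rw [LinearMap.mem_ker]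
      ext x
      obtain ⟨v, rfl⟩ := mk_surjective h x
      exact (Submodule.Quotient.mk_eq_zero _).2 (h.star_mem_left u hu v))

theorem mulMap_mk (u v : V) : mulMap h (mk h u) (mk h v) = mk h (A.star g u v) := rfl

instance : Ring (Ag h) :=
  { (inferInstance : AddCommGroup (Ag h)) with
    mul := fun x y => mulMap h x y
    one := mk h A.vac
    left_distrib := fun x y z => map_add (mulMap h x) y z
    right_distrib := fun x y z => LinearMap.map_add₂ (mulMap h) x y z
    zero_mul := fun x => LinearMap.map_zero₂ (mulMap h) x
    mul_zero := fun x => map_zero (mulMap h x)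
    mul_assoc := fun x y z => by
      obtain ⟨u, rfl⟩ := mk_surjective h x
      obtain ⟨v, rfl⟩ := mk_surjective h y
      obtain ⟨t, rfl⟩ := mk_surjective h z
      exact (mk_eq_mk_iff h).2 (h.assoc u v t)
    one_mul := fun x => by
      obtain ⟨u, rfl⟩ := mk_surjective h x
      exact (mk_eq_mk_iff h).2 (h.one_star u)
    mul_one := fun x => by
      obtain ⟨u, rfl⟩ := mk_surjective h x
      exact (mk_eq_mk_iff h).2 (h.star_one u) }

theorem mk_mul_mk (u v : V) : mk h u * mk h v = mk h (A.star g u v) := rfl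

theorem one_def : (1 : Ag h) = mk h A.vac := rfl

instance : Algebra ℂ (Ag h) :=
  Algebra.ofModule (fun c x y => LinearMap.map_smul₂ (mulMap h) c x y)
    (fun c x y => map_smul (mulMap h x) c y)

end Ag

variable (A)

/-- A weak `g`-twisted `V`-module structure on the complex vector space `M`. `Y v n` is the mode
`v_n`, so `Y_M(v,z) = ∑ₙ v_n z^{-n-1}`. Modes are indexed by all `n : ℚ`; by `support`, only those
with `n ∈ (1/T₀)ℤ` can be nonzero. -/
structure TwistedModuleStruct (g : V ≃ₗ[ℂ] V) (M : Type w) [AddCommGroup M] [Module ℂ M] where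
  Y : V →ₗ[ℂ] (ℚ → Module.End ℂ M)
  /-- `Y_M(u,z) = ∑_{n ∈ r/T₀ + ℤ} u_n z^{-n-1}` for `u ∈ V^r`. -/
  support : ∀ r < orderOf g, ∀ u ∈ eig g r, ∀ n : ℚ,
    (¬ ∃ j : ℤ, n = (r : ℚ) / orderOf g + j) → Y u n = 0
  truncation : ∀ (u : V) (x : M), ∃ N : ℚ, ∀ n : ℚ, N ≤ n → Y u n x = 0
  vac_mode : ∀ n : ℚ, Y A.vac n = if n = -1 then 1 else 0
  /-- The coefficient of `z₀^{-p-1} z₁^{-m-1} z₂^{-n-1}`, with `m ∈ r/T₀ + ℤ`, in the twisted super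
  Jacobi identity for `u ∈ V^r`, applied to a vector `x`. By truncation, all sums over `i` have only
  finitely many nonzero terms. -/
  jacobi : ∀ (k l : ℕ), ∀ r < orderOf g, ∀ u ∈ A.gr k ⊓ eig g r, ∀ v ∈ A.gr l,
    ∀ (x : M) (p j : ℤ) (m n : ℚ), m = (r : ℚ) / orderOf g + j →
    ∑ᶠ i : ℕ, ((-1 : ℂ) ^ i * Ring.choose (p : ℂ) i) •
        (Y u (m + p - i) (Y v (n + i) x) -
          ((-1 : ℂ) ^ p * (-1 : ℂ) ^ (k * l)) • Y v (n + p - i) (Y u (m + i) x)) =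
      ∑ᶠ i : ℕ, (Ring.choose (m : ℂ) i) • Y (A.Y u (p + i) v) (m + n - i) x

/-- The weak `g`-twisted `V`-modules. -/
structure WeakTwistedModule (g : V ≃ₗ[ℂ] V) where
  carrier : Type w
  [addCommGroup : AddCommGroup carrier]
  [module : Module ℂ carrier]
  str : A.TwistedModuleStruct g carrier

attribute [instance] WeakTwistedModule.addCommGroup WeakTwistedModule.module

namespace WeakTwistedModule

variable {A} {g : V ≃ₗ[ℂ] V}

/-- Morphisms of weak `g`-twisted `V`-modules: linear maps commuting with all modes `v_n`. -/
@[ext]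
structure Hom (M N : WeakTwistedModule.{u, w} A g) where
  toLin : M.carrier →ₗ[ℂ] N.carrier
  map_mode : ∀ (v : V) (n : ℚ) (x : M.carrier), toLin (M.str.Y v n x) = N.str.Y v n (toLin x)

instance : CategoryTheory.Category (WeakTwistedModule.{u, w} A g) where
  Hom M N := Hom M N
  id M := ⟨LinearMap.id, fun _ _ _ => rfl⟩
  comp f f' := ⟨f'.toLin.comp f.toLin, fun v n x => by simp [f.map_mode, f'.map_mode]⟩

/-- The space `Ω(M)` of lowest weight vectors: those killed by every mode `u_n` of negative degree
`wt u - n - 1`, for homogeneous `u`. -/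
def Omega (M : WeakTwistedModule.{u, w} A g) : Submodule ℂ M.carrier where
  carrier := {x | ∀ (k : ℕ), ∀ u ∈ A.gr k, ∀ n : ℚ, (k : ℚ) / 2 - 1 < n → M.str.Y u n x = 0}
  zero_mem' := fun _ _ _ _ _ => map_zero _
  add_mem' := fun {x y} hx hy k u hu n hn => by rw [map_add, hx k u hu n hn, hy k u hu n hn, add_zero]
  smul_mem' := fun c x hx k u hu n hn => by rw [map_smul, hx k u hu n hn, smul_zero]

/-- The linear map `a ↦ o(a)`, where `o(a) = a_{wt a - 1}` for homogeneous `a`. -/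
def o (M : WeakTwistedModule.{u, w} A g) : V →ₗ[ℂ] Module.End ℂ M.carrier :=
  A.gradedLift fun k => (LinearMap.proj ((k : ℚ) / 2 - 1)).comp M.str.Y

theorem o_of_mem (M : WeakTwistedModule.{u, w} A g) {k : ℕ} {a : V} (ha : a ∈ A.gr k) :
    M.o a = M.str.Y a ((k : ℚ) / 2 - 1) := by
  simp [o, A.gradedLift_of_mem _ ha]

end WeakTwistedModule

end VertexOperatorSuperalgebra

end

/-! Everything rests on one residue calculus. Integrating the super Jacobi identity against (1+z₁)^α
z₁^{-a} (1+z₂)^β z₂^{-b} (z₁-z₂)^p, and substituting z₁ = z₂ + z₀ on the iterate side, relates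
iterated residues of Y(u,z₁)Y(v,z₂) to residues of Y(u_{p+i}v,z₂); this is
`eventually_resProd_jacobi`. Integration by parts with L(-1) shows that O_g(V) contains not only its
generators but also the residues with deeper poles (`IsAutomorphism.resProd_mem_Og`).

The algebra axioms are then choices of exponents: p = 0 for u * O_g(V) ⊆ O_g(V), p = -1-δ_r for
O_g(V) * x ⊆ O_g(V), p = -1 for associativity. In the last two cases α and β are fixed by requiring
α - i + β = wt(u_{p+i}v), so that the iterate side is a `star` product; all unwanted terms have
poles deep enough to lie in O_g(V).

On a module the twisted Jacobi identity plays the same role. By `IsAutomorphism.exists_mem_eig`, a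
homogeneous u in V^{r*} has nonzero modes only at indices in wt u + r/T + ℤ. Hence the exponent of
(1+z) in ∘_g is an admissible mode index exceeding wt u - 1, which forces o(u ∘ v) = 0 on Ω(M). If r
> 0 then wt u - 1 is not admissible, so o(u) = 0, in accordance with u * v = 0. If r = 0, the case p
= -1 leaves only o(u)o(v). Functoriality holds because morphisms commute with all modes. -/

noncomputable section

namespace VertexOperatorSuperalgebra

open Filter

section

/-! ### Binomial identities for the substitution z₁ = z₂ + z₀ -/

section Binomial

theorem sum_range_antidiagonal_smul {W : Type*} [AddCommGroup W] [Module ℂ W] (f f' : ℕ → ℂ)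
    (h : ℕ → W) (N : ℕ) (hh : ∀ n, N ≤ n → h n = 0) :
    ∑ i ∈ Finset.range N, ∑ j ∈ Finset.range N, (f i * f' j) • h (i + j) =
      ∑ n ∈ Finset.range N,
        (∑ ij ∈ Finset.HasAntidiagonal.antidiagonal n, f ij.1 * f' ij.2) • h n := by
  simp_rw [Finset.sum_smul]
  rw [← Finset.sum_product', Finset.sum_sigma']
  symm
  refine Finset.sum_of_injOn (fun x => x.2) ?_ ?_ ?_ ?_
  · rintro ⟨n, i, j⟩ hx ⟨n', i', j'⟩ hx' hxx
    simp only [Finset.coe_sigma, Set.mem_sigma_iff, Finset.mem_coe, Finset.HasAntidiagonal.mem_antidiagonal] at *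
    obtain ⟨rfl, rfl⟩ := Prod.mk.inj hxx
    obtain rfl : n = n' := by omega
    rfl
  · rintro ⟨n, i, j⟩ hx
    simp only [Finset.coe_sigma, Set.mem_sigma_iff, Finset.mem_coe, Finset.HasAntidiagonal.mem_antidiagonal,
      Finset.mem_range, Finset.coe_product, Set.mem_prod] at *
    omega
  · rintro ⟨i, j⟩ _ hx
    rw [hh, smul_zero]
    by_contra hlt
    exact hx ⟨⟨i + j, i, j⟩, by simpa using hlt, rfl⟩
  · rintro ⟨n, i, j⟩ hx
    simp only [Finset.mem_sigma, Finset.HasAntidiagonal.mem_antidiagonal] at hx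
    simp [hx.2]

theorem sum_range_rotate {W : Type*} [AddCommMonoid W] (N : ℕ) (F : ℕ → ℕ → ℕ → W) :
    ∑ i ∈ Finset.range N, ∑ j ∈ Finset.range N, ∑ j' ∈ Finset.range N, F i j j' =
      ∑ j ∈ Finset.range N, ∑ j' ∈ Finset.range N, ∑ i ∈ Finset.range N, F i j j' := by
  rw [Finset.sum_comm]
  exact Finset.sum_congr rfl fun j _ => Finset.sum_comm

/-- Trinomial revision, (α choose i)(i choose t) = (α choose t)(α-t choose i-t), followed by
Vandermonde. It is the coefficient form of extracting z₀^t from (1+z₂+z₀)^α (1+z₂)^β. -/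
theorem sum_choose_mul_choose (α β : ℂ) (t n : ℕ) :
    ∑ ij ∈ Finset.HasAntidiagonal.antidiagonal (t + n),
        Ring.choose α ij.1 * Ring.choose (ij.1 : ℂ) t * Ring.choose β ij.2 =
      Ring.choose α t * Ring.choose (α - t + β) n := by
  rw [Ring.add_choose_eq n (Commute.all _ _), Finset.Nat.sum_antidiagonal_eq_sum_range_succ_mk,
    Finset.Nat.sum_antidiagonal_eq_sum_range_succ_mk, Nat.succ_eq_add_one, add_assoc, Finset.sum_range_add,
    Finset.mul_sum, Finset.sum_eq_zero, zero_add]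
  · refine Finset.sum_congr rfl fun i _ => ?_
    have h := Ring.choose_smul_choose α (Nat.le_add_right t i)
    rw [nsmul_eq_mul, Nat.add_sub_cancel_left] at h
    rw [Ring.choose_natCast, mul_comm (Ring.choose α (t + i)), h, Nat.add_sub_add_left]
    ring
  · intro i hi
    rw [Ring.choose_natCast, Nat.choose_eq_zero_of_lt (Finset.mem_range.1 hi)]
    simp

theorem sum_choose_mul_choose_of_lt (α β : ℂ) {t n : ℕ} (h : n < t) :
    ∑ ij ∈ Finset.HasAntidiagonal.antidiagonal n,
        Ring.choose α ij.1 * Ring.choose (ij.1 : ℂ) t * Ring.choose β ij.2 = 0 := by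
  refine Finset.sum_eq_zero fun ij hij => ?_
  rw [Finset.HasAntidiagonal.mem_antidiagonal] at hij
  rw [Ring.choose_natCast, Nat.choose_eq_zero_of_lt (by omega)]
  simp

/-- Vandermonde splits (j-a choose i) into Σ (-a choose s)(j choose t): the powers z₀^s and z₀^t
come from (z₂+z₀)^{-a} and (1+z₂+z₀)^α. The sums over j and j' then collapse to the single exponent
α - t + β. -/
theorem sum_sum_choose_smul {W : Type*} [AddCommGroup W] [Module ℂ W] (α β : ℂ) (a : ℤ) (i N : ℕ)
    (h : ℤ → W) (hh : ∀ n : ℕ, N ≤ n → h n = 0) :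
    ∑ j ∈ Finset.range N, ∑ j' ∈ Finset.range N,
        (Ring.choose α j * Ring.choose β j') • (Ring.choose (((j : ℤ) - a : ℤ) : ℂ) i • h (j + j')) =
      ∑ st ∈ Finset.HasAntidiagonal.antidiagonal i, (Ring.choose (-a : ℂ) st.1 * Ring.choose α st.2) •
        ∑ n ∈ Finset.range (N - st.2), Ring.choose (α - st.2 + β) n • h (n + st.2) := by
  have key : ∀ s t : ℕ, ∑ j ∈ Finset.range N, ∑ j' ∈ Finset.range N,
      (Ring.choose (-a : ℂ) s) • ((Ring.choose α j * Ring.choose (j : ℂ) t * Ring.choose β j') •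
        h ((j + j' : ℕ) : ℤ)) = (Ring.choose (-a : ℂ) s * Ring.choose α t) •
        ∑ n ∈ Finset.range (N - t), Ring.choose (α - t + β) n • h (n + t) := by
    intro s t
    simp_rw [← Finset.smul_sum]
    rw [sum_range_antidiagonal_smul (fun j => Ring.choose α j * Ring.choose (j : ℂ) t)
      (fun j => Ring.choose β j) (fun n => h n) N hh, mul_smul]
    congr 1
    rcases le_or_gt N t with hN | hN
    · rw [Nat.sub_eq_zero_of_le hN]
      simp only [Finset.range_zero, Finset.sum_empty, smul_zero]
      refine Finset.sum_eq_zero fun n hn => ?_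
      rw [sum_choose_mul_choose_of_lt _ _ ((Finset.mem_range.1 hn).trans_le hN), zero_smul]
    · obtain ⟨K, rfl⟩ := Nat.exists_eq_add_of_lt hN
      rw [show t + K + 1 = t + (K + 1) by ring, Finset.sum_range_add, Finset.sum_eq_zero, zero_add,
        Nat.add_sub_cancel_left, Finset.smul_sum]
      · refine Finset.sum_congr rfl fun n _ => ?_
        rw [sum_choose_mul_choose, mul_smul]
        congr 3
        push_cast; ring
      · intro n hn
        rw [sum_choose_mul_choose_of_lt _ _ (Finset.mem_range.1 hn), zero_smul]
  simp_rw [← key]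
  rw [Finset.sum_comm (s := Finset.HasAntidiagonal.antidiagonal i)]
  refine Finset.sum_congr rfl fun j _ => ?_
  rw [Finset.sum_comm]
  refine Finset.sum_congr rfl fun j' _ => ?_
  rw [show ((((j : ℤ) - a : ℤ)) : ℂ) = -a + j by push_cast; ring,
    Ring.add_choose_eq i (Commute.all _ _), Finset.sum_smul, Finset.smul_sum]
  refine Finset.sum_congr rfl fun st _ => ?_
  simp only [smul_smul]
  push_cast
  congr 1
  ring

/-- `(i+1) (α choose i+1) = (α - i) (α choose i)`. -/
theorem succ_mul_choose_succ (α : ℂ) (i : ℕ) :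
    ((i : ℂ) + 1) * Ring.choose α (i + 1) = (α - i) * Ring.choose α i := by
  have h := Ring.choose_smul_choose α (Nat.le_add_right i 1)
  rw [Nat.add_sub_cancel_left, Ring.choose_one_right, nsmul_eq_mul, Nat.choose_succ_self_right] at h
  push_cast at h
  rw [h, mul_comm]

end Binomial

/-! ### Residues as finite sums, and the integrated Jacobi identity -/

/-- Residue identities are compared after truncating all sums at one common N. This makes that N
uniform in i when truncation trivializes all but finitely many i. -/
theorem eventually_forall_of_lt {P : ℕ → ℕ → Prop} (I : ℕ) (h : ∀ i < I, ∀ᶠ N in atTop, P i N)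
    (h' : ∀ i, I ≤ i → ∀ N, P i N) : ∀ᶠ N in atTop, ∀ i, P i N := by
  have := (Filter.eventually_all_finset (Finset.range I)).2
    fun i hi => h i (Finset.mem_range.1 hi)
  filter_upwards [this] with N hN i
  rcases lt_or_ge i I with hi | hi
  · exact hN i (Finset.mem_range.2 hi)
  · exact h' i hi N

variable {V : Type u} [AddCommGroup V] [Module ℂ V] (A : VertexOperatorSuperalgebra V)

theorem resProd_eq_sum (α : ℂ) {m : ℤ} {u v : V} {N : ℕ}
    (h : ∀ i : ℕ, N ≤ i → A.Y u (i - m) v = 0) :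
    A.resProd α m u v = ∑ i ∈ Finset.range N, Ring.choose α i • A.Y u (i - m) v := by
  refine finsum_eq_sum_of_support_subset _ fun i hi => ?_
  by_contra hn
  apply hi
  simp only
  rw [h i (by simpa using hn), smul_zero]

theorem eventually_mode_eq_zero (u v : V) (m : ℤ) :
    ∀ᶠ N : ℕ in atTop, ∀ i : ℕ, N ≤ i → A.Y u (i - m) v = 0 := by
  obtain ⟨K, hK⟩ := A.truncation u v
  filter_upwards [eventually_ge_atTop (K + m).toNat] with N hN i hi
  exact hK _ (by omega)

theorem eventually_resProd_eq_sum (α : ℂ) (m : ℤ) (u v : V) :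
    ∀ᶠ N : ℕ in atTop, A.resProd α m u v =
      ∑ i ∈ Finset.range N, Ring.choose α i • A.Y u (i - m) v := by
  filter_upwards [A.eventually_mode_eq_zero u v m] with N hN
  exact A.resProd_eq_sum α hN

theorem resProd_eq_zero_of_le {α : ℂ} {m : ℤ} {u v : V}
    (h : ∀ i : ℕ, A.Y u (i - m) v = 0) : A.resProd α m u v = 0 := by
  rw [A.resProd_eq_sum (N := 0) α fun i _ => h i]; simp

/-- For fixed `x`, the iterated residues of `Y(u,z₁)Y(v,z₂)x` appearing in the Jacobi identity are
uniformly given by finite sums. -/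
theorem eventually_resProd_resProd (α β : ℂ) (a b : ℤ) (u v x : V) :
    ∀ᶠ N : ℕ in atTop, ∀ i : ℕ, A.resProd α (a + i) u (A.resProd β (b - i) v x) =
      ∑ j ∈ Finset.range N, ∑ j' ∈ Finset.range N,
        (Ring.choose α j * Ring.choose β j') • A.Y u (j - (a + i)) (A.Y v (j' - (b - i)) x) := by
  obtain ⟨K, hK⟩ := A.truncation v x
  have h1 : ∀ᶠ N : ℕ in atTop, ∀ i : ℕ, ∀ j : ℕ, N ≤ j →
      A.Y u (j - (a + i)) (A.resProd β (b - i) v x) = 0 := by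
    refine eventually_forall_of_lt (K + b).toNat
      (fun i _ => A.eventually_mode_eq_zero _ _ _) fun i hi N j _ => ?_
    rw [A.resProd_eq_zero_of_le (fun n => hK _ (by omega)), map_zero]
  filter_upwards [h1, eventually_ge_atTop (K + b).toNat] with N hN hKN i
  rw [A.resProd_eq_sum α (hN i),
    A.resProd_eq_sum (N := N) β (fun j hj => hK _ (by omega))]
  simp only [map_sum, map_smul, Finset.smul_sum, smul_smul]

/-- The super Jacobi identity integrated against
`(1+z₁)^α z₁^{-a} (1+z₂)^β z₂^{-b} (z₁-z₂)^p`. -/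
theorem eventually_resProd_jacobi {k l : ℕ} {u v : V} (hu : u ∈ A.gr k) (hv : v ∈ A.gr l) (x : V)
    (p a b : ℤ) (α β : ℂ) : ∀ᶠ N : ℕ in atTop,
    ∑ i ∈ Finset.range N, ((-1 : ℂ) ^ i * Ring.choose (p : ℂ) i) •
        (A.resProd α (a - p + i) u (A.resProd β (b - i) v x) -
          ((-1 : ℂ) ^ p * (-1 : ℂ) ^ (k * l)) •
            A.resProd β (b - p + i) v (A.resProd α (a - i) u x)) =
      ∑ i ∈ Finset.range N, ∑ st ∈ Finset.HasAntidiagonal.antidiagonal i,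
        (Ring.choose (-a : ℂ) st.1 * Ring.choose α st.2) •
          A.resProd (α - st.2 + β) (b + a + st.1) (A.Y u (p + i) v) x := by
  obtain ⟨Kv, hKv⟩ := A.truncation v x
  obtain ⟨Ku, hKu⟩ := A.truncation u x
  obtain ⟨K, hK⟩ := A.truncation u v
  have h5 : ∀ᶠ N : ℕ in atTop, ∀ i : ℕ, ∀ n : ℕ, N ≤ n →
      A.Y (A.Y u (p + i) v) (n - (a + b + i)) x = 0 := by
    refine eventually_forall_of_lt (K - p).toNat
      (fun i _ => A.eventually_mode_eq_zero _ _ _) fun i hi N j _ => ?_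
    rw [hK _ (by omega), map_zero]
    rfl
  filter_upwards [A.eventually_resProd_resProd α β (a - p) b u v x,
    A.eventually_resProd_resProd β α (b - p) a v u x, h5, eventually_ge_atTop (Kv + b).toNat,
    eventually_ge_atTop (Ku + a).toNat, eventually_ge_atTop (K - p).toNat]
    with N h1 h2 h5 h6 h7 h8
  -- The Jacobi identity at m = j - a, n = j' - b, with its three families of modes already cut off
  -- at N.
  have hJ : ∀ j j' : ℕ, ∑ i ∈ Finset.range N, ((-1 : ℂ) ^ i * Ring.choose (p : ℂ) i) •
        (A.Y u (j - (a - p + i)) (A.Y v (j' - (b - i)) x) -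
          ((-1 : ℂ) ^ p * (-1 : ℂ) ^ (k * l)) •
            A.Y v (j' - (b - p + i)) (A.Y u (j - (a - i)) x)) =
      ∑ i ∈ Finset.range N, (Ring.choose (((j : ℤ) - a : ℤ) : ℂ) i) •
        A.Y (A.Y u (p + i) v) ((j + j' : ℤ) - (a + b + i)) x := by
    intro j j'
    have h := A.jacobi k l u hu v hv x p (j - a) (j' - b)
    rw [finsum_eq_sum_of_support_subset (s := Finset.range N),
      finsum_eq_sum_of_support_subset (s := Finset.range N)] at h
    · refine Eq.trans (Finset.sum_congr rfl fun i _ => ?_) (h.trans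
        (Finset.sum_congr rfl fun i _ => ?_))
      · rw [show (j : ℤ) - (a - p + i) = j - a + p - i by ring,
          show (j' : ℤ) - (b - i) = j' - b + i by ring,
          show (j' : ℤ) - (b - p + i) = j' - b + p - i by ring,
          show (j : ℤ) - (a - i) = j - a + i by ring]
      · rw [show (j + j' : ℤ) - (a + b + i) = j - a + (j' - b) - i by ring]
    · intro i hi
      by_contra hn
      apply hi
      simp only [Finset.coe_range, Set.mem_Iio, not_lt] at hn
      simp only
      rw [hK _ (by omega), map_zero]
      simp
    · intro i hi
      by_contra hn
      apply hi
      simp only [Finset.coe_range, Set.mem_Iio, not_lt] at hn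
      simp only
      rw [hKv _ (by omega), hKu _ (by omega)]
      simp
  calc _ = ∑ j ∈ Finset.range N, ∑ j' ∈ Finset.range N,
        (Ring.choose α j * Ring.choose β j') •
        ∑ i ∈ Finset.range N, ((-1 : ℂ) ^ i * Ring.choose (p : ℂ) i) •
        (A.Y u (j - (a - p + i)) (A.Y v (j' - (b - i)) x) -
          ((-1 : ℂ) ^ p * (-1 : ℂ) ^ (k * l)) •
            A.Y v (j' - (b - p + i)) (A.Y u (j - (a - i)) x)) := by
        simp_rw [Finset.smul_sum]
        rw [← sum_range_rotate]
        refine Finset.sum_congr rfl fun i _ => ?_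
        rw [h1, h2, Finset.sum_comm (f := fun j j' =>
          (Ring.choose β j * Ring.choose α j') • A.Y v (j - (b - p + i)) _)]
        simp_rw [Finset.smul_sum, ← Finset.sum_sub_distrib, Finset.smul_sum]
        refine Finset.sum_congr rfl fun j _ => Finset.sum_congr rfl fun j' _ => ?_
        rw [smul_comm (Ring.choose α j * _), mul_comm (Ring.choose β j'),
          smul_comm _ (Ring.choose α j * _) (A.Y v _ _), ← smul_sub]
    _ = ∑ i ∈ Finset.range N, ∑ j ∈ Finset.range N, ∑ j' ∈ Finset.range N,
        (Ring.choose α j * Ring.choose β j') • ((Ring.choose (((j : ℤ) - a : ℤ) : ℂ) i) •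
          A.Y (A.Y u (p + i) v) ((j + j' : ℤ) - (a + b + i)) x) := by
        simp_rw [hJ, Finset.smul_sum]
        rw [← sum_range_rotate]
    _ = _ := by
        refine Finset.sum_congr rfl fun i _ => ?_
        rw [sum_sum_choose_smul α β a i N
          (fun n => A.Y (A.Y u (p + i) v) (n - (a + b + i)) x) (h5 i)]
        refine Finset.sum_congr rfl fun st hst => ?_
        rw [Finset.HasAntidiagonal.mem_antidiagonal] at hst
        have hi : (i : ℤ) = st.1 + st.2 := by exact_mod_cast hst.symm
        have e : ∀ n : ℕ, (n : ℤ) - (b + a + st.1) = n + st.2 - (a + b + i) := fun n => by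
          rw [hi]; ring
        -- After the shift by t, the modes vanish from index N - t on.
        rw [A.resProd_eq_sum (N := N - st.2)]
        · simp_rw [e]
        · intro n hn
          rw [e]
          have := h5 i (n + st.2) (by omega)
          push_cast at this
          exact this

end

/-! ### Exponent shifts in residues, weights and automorphisms -/

section

variable {V : Type u} [AddCommGroup V] [Module ℂ V] (A : VertexOperatorSuperalgebra V)

/-- (1+z)^{α+1} = (1+z)^α + z(1+z)^α, which is Pascal's rule on coefficients. -/
theorem resProd_add_one (α : ℂ) (m : ℤ) (u v : V) :
    A.resProd (α + 1) m u v = A.resProd α m u v + A.resProd α (m - 1) u v := by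
  obtain ⟨N, h1, h2⟩ := ((A.eventually_mode_eq_zero u v m).and
    (A.eventually_mode_eq_zero u v (m - 1))).exists
  rw [A.resProd_eq_sum (N := N + 1) _ fun i hi => h1 i (by omega),
    A.resProd_eq_sum (N := N + 1) _ fun i hi => h1 i (by omega), A.resProd_eq_sum _ h2,
    Finset.sum_range_succ', Finset.sum_range_succ']
  simp_rw [Ring.choose_succ_succ, add_smul, Finset.sum_add_distrib, Ring.choose_zero_right]
  rw [add_assoc, add_comm]
  congr 1
  refine Finset.sum_congr rfl fun i _ => ?_
  rw [show ((i + 1 : ℕ) : ℤ) - m = i - (m - 1) by push_cast; ring]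

/-- Integration by parts for `Res_z (1+z)^{α+1} z^{-m} d/dz Y(u,z)v`. -/
theorem resProd_derivation (α : ℂ) (m : ℤ) (u v : V) :
    A.resProd (α + 1) m (A.Y A.conf 0 u) v =
      ((m : ℂ) - α - 1) • A.resProd α m u v + (m : ℂ) • A.resProd α (m + 1) u v := by
  obtain ⟨N, h1, h2⟩ := ((A.eventually_mode_eq_zero u v m).and
    (A.eventually_mode_eq_zero u v (m + 1))).exists
  rw [A.resProd_eq_sum (N := N + 1) _ fun i hi => ?_, A.resProd_eq_sum (N := N) _ h1,
    A.resProd_eq_sum (N := N + 1) _ fun i hi => h2 i (by omega),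
    Finset.sum_range_succ', Finset.sum_range_succ']
  · simp only [A.derivation, LinearMap.smul_apply, Finset.smul_sum, smul_add, smul_smul]
    rw [← add_assoc, ← Finset.sum_add_distrib]
    congr 1
    · refine Finset.sum_congr rfl fun i _ => ?_
      have e1 : ((i + 1 : ℕ) : ℤ) - m - 1 = i - m := by push_cast; ring
      have e2 : ((i + 1 : ℕ) : ℤ) - (m + 1) = i - m := by push_cast; ring
      rw [e1, e2, ← add_smul]
      congr 1
      have h := succ_mul_choose_succ α i
      rw [Ring.choose_succ_succ]
      push_cast
      linear_combination -h
    · simp only [Ring.choose_zero_right]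
      congr 1
      · push_cast; ring
      · rw [show ((0 : ℕ) : ℤ) - m - 1 = (0 : ℕ) - (m + 1) by ring]
  · rw [A.derivation, LinearMap.smul_apply, show (i : ℤ) - m - 1 = i - (m + 1) by ring,
      h2 i (by omega), smul_zero]

/-- The eigenspace of `L(0)` with eigenvalue `c`. -/
def wt (c : ℂ) : Submodule ℂ V := Module.End.eigenspace (A.Y A.conf 1) c

theorem mem_wt {c : ℂ} {v : V} : v ∈ A.wt c ↔ A.Y A.conf 1 v = c • v :=
  Module.End.mem_eigenspace_iff

theorem gr_le_wt (k : ℕ) : A.gr k ≤ A.wt ((k : ℂ) / 2) := fun v hv => A.mem_wt.2 (A.weight k v hv)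

theorem component_grEquiv_symm_L_zero (k : ℕ) (v : V) :
    A.grEquiv.symm (A.Y A.conf 1 v) k = ((k : ℂ) / 2) • A.grEquiv.symm v k := by
  have h : (DirectSum.component ℂ ℕ _ k).comp (A.grEquiv.symm.toLinearMap.comp (A.Y A.conf 1)) =
      ((k : ℂ) / 2) • (DirectSum.component ℂ ℕ _ k).comp A.grEquiv.symm.toLinearMap := by
    refine A.hom_ext_gr fun l x hx => ?_
    simp only [LinearMap.comp_apply, LinearMap.smul_apply, LinearEquiv.coe_coe]
    rw [A.weight l x hx, map_smul, A.grEquiv_symm_of_mem hx, map_smul]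
    rcases eq_or_ne l k with rfl | hlk
    · rfl
    · rw [DirectSum.component.of, dif_neg hlk, smul_zero, smul_zero]
  exact LinearMap.congr_fun h v

/-- A weight vector is homogeneous. -/
theorem mem_gr_of_mem_wt {c : ℂ} {v : V} (hv : v ∈ A.wt c) :
    v = 0 ∨ ∃ k : ℕ, c = (k : ℂ) / 2 ∧ v ∈ A.gr k := by
  by_cases h0 : v = 0
  · exact Or.inl h0
  refine Or.inr ?_
  -- L(0) scales the k-th component both by c and by k/2.
  have key : ∀ k : ℕ, c ≠ (k : ℂ) / 2 → A.grEquiv.symm v k = 0 := by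
    intro k hk
    have h := A.component_grEquiv_symm_L_zero k v
    rw [A.mem_wt.1 hv, map_smul, DirectSum.smul_apply, ← sub_eq_zero, ← sub_smul,
      smul_eq_zero] at h
    exact h.resolve_left (sub_ne_zero.2 hk)
  obtain ⟨k, hk⟩ : ∃ k, A.grEquiv.symm v k ≠ 0 := by
    by_contra! h
    exact h0 ((LinearEquiv.map_eq_zero_iff A.grEquiv.symm).1 (DFinsupp.ext h))
  have hc : c = (k : ℂ) / 2 := by
    by_contra h
    exact hk (key k h)
  refine ⟨k, hc, ?_⟩
  have hf : A.grEquiv.symm v = DirectSum.lof ℂ ℕ (fun k => A.gr k) k (A.grEquiv.symm v k) := by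
    refine DFinsupp.ext fun l => ?_
    change _ = DirectSum.component ℂ ℕ _ l (DirectSum.lof ℂ ℕ (fun k => A.gr k) k _)
    rcases eq_or_ne k l with rfl | hkl
    · rw [DirectSum.component.lof_self]
    · rw [DirectSum.component.of, dif_neg hkl]
      refine key l fun h => hkl ?_
      have := hc.symm.trans h
      field_simp at this
      exact_mod_cast this
  rw [LinearEquiv.symm_apply_eq] at hf
  rw [hf]
  exact (DirectSum.coeLinearMap_lof A.gr k _) ▸ (A.grEquiv.symm v k).2

/-- `[L(0), u_n] = (wt u - n - 1) u_n`. -/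
theorem mode_mem_wt {c d : ℂ} {u v : V} (hu : u ∈ A.wt c) (hv : v ∈ A.wt d) (n : ℤ) :
    A.Y u n v ∈ A.wt (c + d - n - 1) := by
  rcases A.mem_gr_of_mem_wt hu with rfl | ⟨k, rfl, hk⟩
  · rw [map_zero]; exact zero_mem _
  -- At p = 0, m = 1 only finitely many terms survive: [ω_1, u_n] = (ω_0 u)_{n+1} + (ω_1 u)_n, with
  -- ω_0 = L(-1) and ω_1 = L(0).
  have h := A.jacobi 4 k A.conf A.conf_mem u hk v 0 1 n
  rw [finsum_eq_sum_of_support_subset (s := Finset.range 1),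
    finsum_eq_sum_of_support_subset (s := Finset.range 2)] at h
  · rw [Finset.sum_range_one, Finset.sum_range_succ, Finset.sum_range_one] at h
    have e : (-1 : ℂ) ^ (4 * k) = 1 := by rw [pow_mul]; norm_num
    simp only [Ring.choose_zero_right, Ring.choose_one_right, Nat.cast_zero, Nat.cast_one, pow_zero,
      zpow_zero, Int.cast_one, one_smul, mul_one, add_zero, sub_zero, zero_add, e, A.derivation,
      A.weight k u hk, A.mem_wt.1 hv, map_smul, LinearMap.smul_apply, Pi.smul_apply,
      add_sub_cancel_left] at h
    rw [A.mem_wt, ← sub_eq_zero]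
    rw [← sub_eq_zero] at h
    rw [← h]
    push_cast
    module
  · intro i hi
    by_contra hn
    apply hi
    simp only [Finset.coe_range, Set.mem_Iio, not_lt] at hn
    simp only
    rw [Int.cast_one, ← Nat.cast_one, Ring.choose_natCast, Nat.choose_eq_zero_of_lt (by omega),
      Nat.cast_zero, zero_smul]
  · intro i hi
    by_contra hn
    apply hi
    simp only [Finset.coe_range, Set.mem_Iio, not_lt] at hn
    simp only
    rw [Int.cast_zero, Ring.choose_zero_pos ℂ (by omega), mul_zero, zero_smul]

theorem sigma_of_mem {k : ℕ} {v : V} (hv : v ∈ A.gr k) : A.sigma v = (-1 : ℂ) ^ k • v :=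
  A.parityMap_of_mem hv

section Automorphism

variable {A} {g : V ≃ₗ[ℂ] V} (hg : A.IsAutomorphism g)
include hg

theorem IsAutomorphism.map_vac : g A.vac = A.vac := by
  have h := hg.2 A.vac (-1) (g.symm A.vac)
  rw [A.vac_mode, if_pos rfl, LinearEquiv.apply_symm_apply, A.creation_limit] at h
  rw [← h]; simp

theorem IsAutomorphism.map_mem_gr {k : ℕ} {v : V} (hv : v ∈ A.gr k) : g v ∈ A.gr k := by
  have h : g v ∈ A.wt ((k : ℂ) / 2) := by
    rw [mem_wt]
    have := hg.2 A.conf 1 v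
    rw [hg.1, A.weight k v hv, map_smul] at this
    exact this.symm
  rcases A.mem_gr_of_mem_wt h with h0 | ⟨l, hl, hl'⟩
  · rw [h0]; exact zero_mem _
  · obtain rfl : k = l := by field_simp at hl; exact_mod_cast hl
    exact hl'

theorem IsAutomorphism.twist_mem_gr {k : ℕ} {v : V} (hv : v ∈ A.gr k) :
    (g * A.sigma) v ∈ A.gr k := by
  rw [LinearEquiv.mul_apply, A.sigma_of_mem hv, map_smul]
  exact Submodule.smul_mem _ _ (hg.map_mem_gr hv)

theorem IsAutomorphism.commute_sigma : Commute g A.sigma := by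
  have h : (g : V →ₗ[ℂ] V).comp (A.sigma : V →ₗ[ℂ] V) = (A.sigma : V →ₗ[ℂ] V).comp (g : V →ₗ[ℂ] V) := by
    refine A.hom_ext_gr fun k v hv => ?_
    simp [A.sigma_of_mem hv, A.sigma_of_mem (hg.map_mem_gr hv)]
  exact LinearEquiv.ext fun v => LinearMap.congr_fun h v

theorem IsAutomorphism.ordT_pos (hfin : IsOfFinOrder g) : 0 < A.ordT g := by
  refine orderOf_pos_iff.2 (hg.commute_sigma.isOfFinOrder_mul hfin ?_)
  refine isOfFinOrder_iff_pow_eq_one.2 ⟨2, two_pos, LinearEquiv.ext fun v => ?_⟩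
  rw [pow_two]
  exact A.parityMap_involutive v

/-- The product of modes of eigenvectors of `gσ` with eigenvalues `ξ`, `η` has eigenvalue `ξη`. -/
theorem IsAutomorphism.twist_mode {c d ξ η : ℂ} {u v : V} (hu : u ∈ A.wt c) (hv : v ∈ A.wt d)
    (hu' : (g * A.sigma) u = ξ • u) (hv' : (g * A.sigma) v = η • v) (n : ℤ) :
    (g * A.sigma) (A.Y u n v) = (ξ * η) • A.Y u n v := by
  have h := A.mode_mem_wt hu hv n
  rcases A.mem_gr_of_mem_wt hu with rfl | ⟨k, rfl, hk⟩
  · simp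
  rcases A.mem_gr_of_mem_wt hv with rfl | ⟨l, rfl, hl⟩
  · simp
  rcases A.mem_gr_of_mem_wt h with h0 | ⟨j, hj, hj'⟩
  · simp [h0]
  rw [LinearEquiv.mul_apply] at *
  rw [A.sigma_of_mem hj', map_smul, hg.2]
  rw [A.sigma_of_mem hk, map_smul] at hu'
  rw [A.sigma_of_mem hl, map_smul] at hv'
  -- The weight of u_n v determines its parity, so σ is multiplicative on modes.
  have e : (j : ℤ) = k + l - 2 * (n + 1) := by
    have : ((j : ℤ) : ℂ) = ((k + l - 2 * (n + 1) : ℤ) : ℂ) := by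
      push_cast; linear_combination -2 * hj
    exact_mod_cast this
  have e2 : (-1 : ℂ) ^ j = (-1) ^ k * (-1) ^ l := by
    rw [← zpow_natCast, e, zpow_sub₀ (by norm_num), zpow_mul, zpow_add₀ (by norm_num)]
    norm_num
  calc _ = A.Y ((-1 : ℂ) ^ k • g u) n ((-1 : ℂ) ^ l • g v) := by
        rw [e2, map_smul, map_smul, Pi.smul_apply, LinearMap.smul_apply, smul_smul, mul_comm]
    _ = _ := by rw [hu', hv', map_smul, map_smul, Pi.smul_apply, LinearMap.smul_apply, smul_smul, mul_comm]

end Automorphism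

theorem mem_eigStar {g : V ≃ₗ[ℂ] V} {r : ℕ} {v : V} : v ∈ A.eigStar g r ↔
    (g * A.sigma) v = Complex.exp (2 * Real.pi * Complex.I * r / A.ordT g) • v :=
  Module.End.mem_eigenspace_iff

theorem mem_eigStar_zero {g : V ≃ₗ[ℂ] V} {v : V} : v ∈ A.eigStar g 0 ↔ (g * A.sigma) v = v := by
  simp [mem_eigStar]

theorem exp_eq_pow (T r : ℕ) : Complex.exp (2 * Real.pi * Complex.I * r / T) =
    Complex.exp (2 * Real.pi * Complex.I / T) ^ r := by
  rw [← Complex.exp_nat_mul]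
  congr 1
  ring

end

/-! ### Decomposition into eigenvectors of gσ -/

section

/-- A vector of an invariant subspace of an operator of finite order is a sum of eigenvectors in
that subspace. -/
theorem mem_of_eigenvectors_mem {V : Type*} [AddCommGroup V] [Module ℂ V] {f : Module.End ℂ V}
    {T : ℕ} (hT : 0 < T) (hf : f ^ T = 1) {p P : Submodule ℂ V} (hp : ∀ v ∈ p, f v ∈ p)
    (h : ∀ r < T, ∀ v ∈ p, f v = Complex.exp (2 * Real.pi * Complex.I / T) ^ r • v → v ∈ P)
    {v : V} (hv : v ∈ p) : v ∈ P := by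
  have hprim := Complex.isPrimitiveRoot_exp T hT.ne'
  set ζ := Complex.exp (2 * Real.pi * Complex.I / T)
  have hζ : ζ ≠ 0 := Complex.exp_ne_zero _
  have hpow : ∀ j, (f ^ j) v ∈ p := by
    intro j
    induction j with
    | zero => simpa using hv
    | succ j ih => rw [pow_succ', Module.End.mul_apply]; exact hp _ ih
  -- The r-th discrete Fourier component of v; shifting j cyclically (f^T = 1) shows that it is an
  -- eigenvector with eigenvalue ζ^r.
  have hQ : ∀ r < T, ∑ j ∈ Finset.range T, (ζ ^ r)⁻¹ ^ j • (f ^ j) v ∈ P := by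
    intro r hr
    refine h r hr _ (Submodule.sum_mem _ fun j _ => Submodule.smul_mem _ _ (hpow j)) ?_
    have h1 := Finset.sum_range_succ (fun j => (ζ ^ r)⁻¹ ^ j • (f ^ j) v) T
    rw [Finset.sum_range_succ'] at h1
    have h2 : (ζ ^ r)⁻¹ ^ T = 1 := by
      rw [inv_pow, pow_right_comm, hprim.pow_eq_one, one_pow, inv_one]
    simp only [hf, h2, pow_zero, add_left_inj] at h1
    conv_rhs => rw [← h1]
    rw [map_sum, Finset.smul_sum]
    refine Finset.sum_congr rfl fun j _ => ?_
    rw [map_smul, smul_smul, pow_succ' (ζ ^ r)⁻¹, ← mul_assoc,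
      mul_inv_cancel₀ (pow_ne_zero _ hζ), one_mul, pow_succ' f, Module.End.mul_apply]
  -- Fourier inversion: summing over r first, a geometric sum kills every j ≠ 0.
  have hsum : ∑ r ∈ Finset.range T, ∑ j ∈ Finset.range T, (ζ ^ r)⁻¹ ^ j • (f ^ j) v =
      (T : ℂ) • v := by
    rw [Finset.sum_comm, ← Finset.sum_erase_add _ _ (Finset.mem_range.2 hT),
      Finset.sum_eq_zero, zero_add]
    · simp [Nat.cast_smul_eq_nsmul]
    · intro j hj
      rw [Finset.mem_erase, Finset.mem_range] at hj
      have e : ∀ r, (ζ ^ r)⁻¹ ^ j = (ζ ^ j)⁻¹ ^ r := fun r => by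
        rw [inv_pow, inv_pow, pow_right_comm]
      simp_rw [e]
      rw [← Finset.sum_smul, geom_sum_eq, inv_pow, pow_right_comm, hprim.pow_eq_one]
      · simp
      · rw [Ne, inv_eq_one]
        exact hprim.pow_ne_one_of_pos_of_lt hj.1 hj.2
  have hT' : (T : ℂ) ≠ 0 := by exact_mod_cast hT.ne'
  rw [← inv_smul_smul₀ hT' v, ← hsum]
  exact Submodule.smul_mem _ _ (Submodule.sum_mem _ fun r hr => hQ r (Finset.mem_range.1 hr))

variable {V : Type u} [AddCommGroup V] [Module ℂ V] (A : VertexOperatorSuperalgebra V)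

section Homogeneous

variable {A} {g : V ≃ₗ[ℂ] V}

theorem exp_mul_exp_eq_one_iff {T r s : ℕ} (hT : 0 < T) :
    Complex.exp (2 * Real.pi * Complex.I * r / T) * Complex.exp (2 * Real.pi * Complex.I * s / T) =
      1 ↔ T ∣ r + s := by
  rw [exp_eq_pow, exp_eq_pow, ← pow_add,
    (Complex.isPrimitiveRoot_exp T hT.ne').pow_eq_one_iff_dvd]

variable (hg : A.IsAutomorphism g) (hfin : IsOfFinOrder g)
include hg hfin

/-- A homogeneous vector is a sum of homogeneous eigenvectors of `gσ`. -/
theorem IsAutomorphism.gr_le {P : Submodule ℂ V} {k : ℕ}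
    (h : ∀ r < A.ordT g, ∀ v ∈ A.gr k ⊓ A.eigStar g r, v ∈ P) : A.gr k ≤ P := by
  intro v hv
  refine mem_of_eigenvectors_mem (f := ((g * A.sigma : V ≃ₗ[ℂ] V) : V →ₗ[ℂ] V))
    (hg.ordT_pos hfin) ?_ (fun v hv => hg.twist_mem_gr hv) (fun r hr v hv hv' => h r hr v ⟨hv, ?_⟩)
    hv
  · have e := pow_orderOf_eq_one (g * A.sigma)
    refine LinearMap.ext fun x => ?_
    have e' : ((g * A.sigma) ^ A.ordT g) x = x := by
      rw [ordT, e]; rfl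
    rw [LinearEquiv.coe_pow] at e'
    rw [Module.End.pow_apply]
    exact e'
  · exact A.mem_eigStar.2 (by rw [exp_eq_pow]; exact hv')

/-- Homogeneous eigenvectors of `gσ` span `V`. -/
theorem IsAutomorphism.homogeneous_induction {P : Submodule ℂ V}
    (h : ∀ k : ℕ, ∀ r < A.ordT g, ∀ v ∈ A.gr k ⊓ A.eigStar g r, v ∈ P) (v : V) : v ∈ P := by
  have hv : v ∈ ⨆ k, A.gr k := by
    rw [A.isInternal.submodule_iSup_eq_top]; trivial
  exact iSup_le (fun k => hg.gr_le hfin (h k)) hv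

end Homogeneous

/-! ### Elements of O_g(V) -/

section Og

variable {A} {g : V ≃ₗ[ℂ] V}

/-- Allowing a complex weight c avoids checking that the weight of u_n v is a nonnegative
half-integer: otherwise the vector is zero. -/
theorem resProd_mem_Og_of_mem_wt {r : ℕ} (hr : r < A.ordT g) {c : ℂ} {u : V}
    (hu : u ∈ A.wt c) (hu' : u ∈ A.eigStar g r) (v : V) :
    A.resProd (c - 1 + delta r + (r : ℂ) / A.ordT g) (1 + delta r) u v ∈ A.Og g := by
  rcases A.mem_gr_of_mem_wt hu with rfl | ⟨k, rfl, hk⟩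
  · rw [map_zero]; exact zero_mem _
  · exact Submodule.subset_span ⟨k, r, hr, u, ⟨hk, hu'⟩, v, rfl⟩

theorem conf_mem_wt : A.conf ∈ A.wt 2 := by
  convert A.gr_le_wt 4 A.conf_mem using 2
  norm_num

theorem vac_mem_wt : A.vac ∈ A.wt 0 := by
  simpa using A.gr_le_wt 0 A.vac_mem

variable (hg : A.IsAutomorphism g)
include hg

theorem IsAutomorphism.twist_conf : (g * A.sigma) A.conf = A.conf := by
  rw [LinearEquiv.mul_apply, A.sigma_of_mem A.conf_mem, map_smul, hg.1]
  norm_num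

theorem IsAutomorphism.twist_vac : (g * A.sigma) A.vac = A.vac := by
  rw [LinearEquiv.mul_apply, A.sigma_of_mem A.vac_mem, map_smul, hg.map_vac]
  norm_num

/-- L(-1)u has weight c + 1 and the same gσ-eigenvalue as u. Applying the induction hypothesis to it
and integrating by parts raises the pole order by one, modulo the hypothesis for u itself. -/
theorem IsAutomorphism.resProd_mem_Og_aux {r : ℕ} (hr : r < A.ordT g) (m : ℕ) {c : ℂ} {u : V}
    (hu : u ∈ A.wt c) (hu' : u ∈ A.eigStar g r) (v : V) :
    A.resProd (c - 1 + delta r + (r : ℂ) / A.ordT g) (1 + delta r + m) u v ∈ A.Og g := by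
  induction m generalizing c u with
  | zero => simpa using resProd_mem_Og_of_mem_wt hr hu hu' v
  | succ m ih =>
    have hω : A.Y A.conf 0 u ∈ A.wt (c + 1) := by
      convert A.mode_mem_wt (conf_mem_wt) hu 0 using 2
      push_cast; ring
    have hω' : A.Y A.conf 0 u ∈ A.eigStar g r := by
      rw [mem_eigStar] at hu' ⊢
      have := hg.twist_mode conf_mem_wt hu (ξ := 1) (by rw [hg.twist_conf, one_smul]) hu' 0
      rwa [one_mul] at this
    have h := ih hω hω'
    rw [show c + 1 - 1 + (delta r : ℂ) + (r : ℂ) / A.ordT g =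
      (c - 1 + delta r + (r : ℂ) / A.ordT g) + 1 by ring, resProd_derivation] at h
    have h2 := (Submodule.add_mem_iff_right _ (Submodule.smul_mem _ _ (ih hu hu'))).1 h
    -- The coefficient of the deeper pole is the old pole order, which is at least 1.
    have hne : ((1 + delta r + m : ℤ) : ℂ) ≠ 0 := by
      have : (1 + delta r + m : ℤ) ≠ 0 := by omega
      exact_mod_cast this
    rw [Submodule.smul_mem_iff _ hne] at h2
    rwa [Nat.cast_succ, ← add_assoc]

/-- `Res_z (1+z)^{wt u - 1 + δ_r + r/T + n} z^{-1-δ_r-m} Y(u,z)v` lies in `O_g(V)` for `n ≤ m`. -/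
theorem IsAutomorphism.resProd_mem_Og {r : ℕ} (hr : r < A.ordT g) {c : ℂ} {u : V}
    (hu : u ∈ A.wt c) (hu' : u ∈ A.eigStar g r) (v : V) {n m : ℕ} (hnm : n ≤ m) :
    A.resProd (c - 1 + delta r + (r : ℂ) / A.ordT g + n) (1 + delta r + m) u v ∈ A.Og g := by
  induction n generalizing m with
  | zero => simpa using hg.resProd_mem_Og_aux hr m hu hu' v
  | succ n ih =>
    obtain ⟨m, rfl⟩ := Nat.exists_eq_add_of_le' hnm
    -- Each extra factor 1+z costs at most one pole order, hence the condition n ≤ m.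
    rw [Nat.cast_succ, ← add_assoc, resProd_add_one]
    refine Submodule.add_mem _ (ih (by omega)) ?_
    have := ih (m := m + n) (by omega)
    rwa [show (1 + delta r + (m + n : ℕ) : ℤ) = 1 + delta r + (m + (n + 1) : ℕ) - 1 by
      push_cast; ring] at this

omit hg in
/-- Nonzero eigenspaces of `gσ` lie in `O_g(V)`. -/
theorem eigStar_le_Og {r : ℕ} (hr : r < A.ordT g) (hr0 : r ≠ 0) {k : ℕ} {u : V}
    (hu : u ∈ A.gr k ⊓ A.eigStar g r) : u ∈ A.Og g := by
  have h := resProd_mem_Og_of_mem_wt hr (A.gr_le_wt k hu.1) hu.2 A.vac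
  rw [resProd_eq_sum (N := 1)] at h
  · simpa [delta, hr0, A.creation_limit] using h
  · intro i hi
    exact A.creation _ _ (by simp [delta, hr0]; omega)

end Og

/-! ### The product on eigenvectors -/

section Star

variable {A} {g : V ≃ₗ[ℂ] V}

theorem star_of_mem_wt (hT : 0 < A.ordT g) {c : ℂ} {u : V} (hu : u ∈ A.wt c)
    (hu' : (g * A.sigma) u = u) (v : V) : A.star g u v = A.resProd c 1 u v := by
  rcases A.mem_gr_of_mem_wt hu with rfl | ⟨k, rfl, hk⟩
  · simp
  · exact A.star_of_mem_zero hT hk (A.mem_eigStar_zero.2 hu') v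

/-- `u *_g v = 0` for an eigenvector `u` of `gσ` with eigenvalue different from `1`. -/
theorem star_eq_zero (hT : 0 < A.ordT g) {c ξ : ℂ} {u : V} (hu : u ∈ A.wt c) (hξ : ξ ≠ 1)
    (hξT : ξ ^ A.ordT g = 1) (hu' : (g * A.sigma) u = ξ • u) (v : V) : A.star g u v = 0 := by
  rcases A.mem_gr_of_mem_wt hu with rfl | ⟨k, rfl, hk⟩
  · simp
  have := NeZero.of_pos hT
  obtain ⟨r, hr, rfl⟩ := (Complex.isPrimitiveRoot_exp _ hT.ne').eq_pow_of_pow_eq_one hξT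
  refine A.star_of_mem_pos (Nat.pos_of_ne_zero ?_) hr hk ?_ v
  · rintro rfl
    simp at hξ
  · rwa [mem_eigStar, exp_eq_pow]

end Star

end

/-! ### The algebra structure on A_g(V) -/

section

variable {V : Type u} [AddCommGroup V] [Module ℂ V] {A : VertexOperatorSuperalgebra V}

/-- The super Jacobi identity integrated against `(1+z₁)^α (1+z₂)^β z₂^{-b} (z₁-z₂)^p`. -/
theorem eventually_resProd_assoc {k l : ℕ} {u v : V} (hu : u ∈ A.gr k) (hv : v ∈ A.gr l) (x : V)
    (p b : ℤ) (α β : ℂ) : ∀ᶠ N : ℕ in atTop,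
    ∑ i ∈ Finset.range N, Ring.choose α i • A.resProd (α - i + β) b (A.Y u (p + i) v) x =
    ∑ i ∈ Finset.range N, ((-1 : ℂ) ^ i * Ring.choose (p : ℂ) i) •
        (A.resProd α (-p + i) u (A.resProd β (b - i) v x) -
          ((-1 : ℂ) ^ p * (-1 : ℂ) ^ (k * l)) •
            A.resProd β (b - p + i) v (A.resProd α (-i) u x)) := by
  filter_upwards [A.eventually_resProd_jacobi hu hv x p 0 b α β] with N hN
  simp only [zero_sub] at hN
  rw [hN]
  refine Finset.sum_congr rfl fun i _ => ?_
  -- Here a = 0, so (z₂+z₀)^{-a} = 1 and only s = 0 contributes.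
  rw [Finset.sum_eq_single (0, i)]
  · simp
  · rintro ⟨s, t⟩ hst h
    rw [Finset.HasAntidiagonal.mem_antidiagonal] at hst
    have hs : 0 < s := by
      rcases Nat.eq_zero_or_pos s with rfl | hs
      · exact absurd (by simpa using hst) (by simpa using h)
      · exact hs
    simp [Ring.choose_zero_pos ℂ hs]
  · simp

variable {g : V ≃ₗ[ℂ] V} (hg : A.IsAutomorphism g) (hfin : IsOfFinOrder g)
include hg hfin

/-- For u in V^{0*} the commutator formula (p = 0) writes u * (a ∘ b) as a scalar multiple of a ∘ (u
* b) plus residues of the u_i a, which have the same gσ-eigenvalue as a. -/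
theorem IsAutomorphism.star_mem_Og_right (u : V) {v : V} (hv : v ∈ A.Og g) :
    A.star g u v ∈ A.Og g := by
  have hT := hg.ordT_pos hfin
  have : u ∈ (A.Og g).comap ((A.star g).flip v) := by
    refine hg.homogeneous_induction hfin ?_ u
    rintro k s hs u ⟨hk, hu⟩
    rw [Submodule.mem_comap, LinearMap.flip_apply]
    rcases Nat.eq_zero_or_pos s with rfl | hs0
    swap
    · rw [A.star_of_mem_pos hs0 hs hk hu]; exact zero_mem _
    have hu1 := A.mem_eigStar_zero.1 hu
    suffices h : A.Og g ≤ (A.Og g).comap (A.star g u) from h hv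
    refine Submodule.span_le.2 ?_
    rintro _ ⟨l, r, hr, a, ⟨hl, ha⟩, b, rfl⟩
    rw [SetLike.mem_coe, Submodule.mem_comap, star_of_mem_wt hT (A.gr_le_wt k hk) hu1]
    obtain ⟨N, hN, hN1⟩ := ((A.eventually_resProd_jacobi hk hl b 0 1 (1 + delta r) ((k : ℂ) / 2)
      ((l : ℂ) / 2 - 1 + delta r + (r : ℂ) / A.ordT g)).and (eventually_ge_atTop 1)).exists
    rw [Finset.sum_eq_single 0] at hN
    · simp only [pow_zero, Ring.choose_zero_right, mul_one, one_smul, Nat.cast_zero, sub_zero,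
        add_zero, sub_eq_iff_eq_add] at hN
      rw [hN]
      refine Submodule.add_mem _ (Submodule.sum_mem _ fun i _ => Submodule.sum_mem _ fun st hst =>
        Submodule.smul_mem _ _ ?_) (Submodule.smul_mem _ _
          (Submodule.subset_span ⟨l, r, hr, a, ⟨hl, ha⟩, _, rfl⟩))
      rw [Finset.HasAntidiagonal.mem_antidiagonal] at hst
      have h1 := A.mode_mem_wt (A.gr_le_wt k hk) (A.gr_le_wt l hl) (0 + i)
      have h2 := hg.twist_mode (A.gr_le_wt k hk) (A.gr_le_wt l hl) (ξ := 1)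
        (by rw [hu1, one_smul]) (A.mem_eigStar.1 ha) (0 + i)
      rw [one_mul] at h2
      -- Since i = s + t, the exponent exceeds that of a generator by s + 1, exactly as much as the
      -- pole order does.
      have h3 := hg.resProd_mem_Og hr h1 (A.mem_eigStar.2 h2) b (le_refl (st.1 + 1))
      convert h3 using 4
      · rw [← hst]; push_cast; ring
      · push_cast; ring
    · intro i _ hi
      rw [Int.cast_zero, Ring.choose_zero_pos ℂ (Nat.pos_of_ne_zero hi), mul_zero, zero_smul]
    · simp; omega
  exact this

omit hg hfin in
-- The hypotheses force r = s = 0 or r + s = T.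
theorem delta_eq_of_dvd {T r s : ℕ} (hr : r < T) (hs : s < T) (h : T ∣ r + s) :
    delta s = delta r ∧ (1 : ℂ) - r / T = delta s + s / T := by
  have hT : (T : ℂ) ≠ 0 := by exact_mod_cast (by omega : T ≠ 0)
  rcases Nat.eq_zero_or_pos r with rfl | hr0
  · obtain rfl : s = 0 := Nat.eq_zero_of_dvd_of_lt (by simpa using h) hs
    simp [delta]
  · obtain ⟨c, hc⟩ := h
    obtain rfl : c = 1 := by
      have h1 : 0 < c := Nat.pos_of_ne_zero (by rintro rfl; omega)
      have h2 : c < 2 := by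
        by_contra h2
        have := Nat.mul_le_mul_left T (not_lt.1 h2)
        omega
      omega
    have hs0 : s ≠ 0 := by omega
    refine ⟨by simp [delta, hr0.ne', hs0], ?_⟩
    have : (r : ℂ) + s = T := by exact_mod_cast (by omega : r + s = T)
    rw [delta, if_neg hs0]
    field_simp
    rw [← this]; push_cast; ring

/-- If T ∤ r + s, every a_n b has gσ-eigenvalue different from 1 and the product vanishes. Otherwise
the iterate formula with p = -1-δ_r turns (a ∘ b) * x into residues with deep poles in a or in b. -/
theorem IsAutomorphism.star_mem_Og_left {u : V} (hu : u ∈ A.Og g) (x : V) :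
    A.star g u x ∈ A.Og g := by
  have hT := hg.ordT_pos hfin
  suffices h : A.Og g ≤ (A.Og g).comap ((A.star g).flip x) from h hu
  refine Submodule.span_le.2 ?_
  rintro _ ⟨k, r, hr, a, ⟨hk, ha⟩, b, rfl⟩
  rw [SetLike.mem_coe]
  set α : ℂ := (k : ℂ) / 2 - 1 + delta r + (r : ℂ) / A.ordT g with hα
  suffices h : b ∈ ((A.Og g).comap ((A.star g).flip x)).comap (A.resProd α (1 + delta r) a) from h
  refine hg.homogeneous_induction hfin ?_ b
  rintro l s hs b ⟨hl, hb⟩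
  rw [Submodule.mem_comap, Submodule.mem_comap, LinearMap.flip_apply]
  have hwt := fun i : ℕ =>
    A.mode_mem_wt (A.gr_le_wt k hk) (A.gr_le_wt l hl) (-(1 + delta r : ℤ) + i)
  have hξ := fun i : ℕ => hg.twist_mode (A.gr_le_wt k hk) (A.gr_le_wt l hl) (A.mem_eigStar.1 ha)
    (A.mem_eigStar.1 hb) (-(1 + delta r : ℤ) + i)
  have hsum : ∀ᶠ N in atTop, A.star g (A.resProd α (1 + delta r) a b) x =
      ∑ i ∈ Finset.range N,
        Ring.choose α i • A.star g (A.Y a (-(1 + delta r : ℤ) + i) b) x := by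
    filter_upwards [A.eventually_resProd_eq_sum α (1 + delta r) a b] with N hN
    rw [hN, map_sum, LinearMap.sum_apply]
    refine Finset.sum_congr rfl fun i _ => ?_
    rw [map_smul, LinearMap.smul_apply, sub_eq_neg_add]
  by_cases hrs : A.ordT g ∣ r + s
  · obtain ⟨hδ, hδ'⟩ := delta_eq_of_dvd hr hs hrs
    have hmul := (exp_mul_exp_eq_one_iff hT).2 hrs
    obtain ⟨N, hN, hJ⟩ := (hsum.and (eventually_resProd_assoc hk hl x (-(1 + delta r)) 1 α
      ((l : ℂ) / 2 + 1 - (r : ℂ) / A.ordT g))).exists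
    rw [hN]
    have hN' : ∑ i ∈ Finset.range N,
        Ring.choose α i • A.star g (A.Y a (-(1 + delta r : ℤ) + i) b) x =
        ∑ i ∈ Finset.range N, Ring.choose α i •
          A.resProd (α - i + ((l : ℂ) / 2 + 1 - (r : ℂ) / A.ordT g)) 1
            (A.Y a (-(1 + delta r : ℤ) + i) b) x := by
      refine Finset.sum_congr rfl fun i _ => ?_
      rw [star_of_mem_wt hT (hwt i) (by rw [hξ i, hmul, one_smul])]
      congr 4
      rw [hα]; push_cast; ring
    rw [hN', hJ]
    refine Submodule.sum_mem _ fun i _ => Submodule.smul_mem _ _ (Submodule.sub_mem _ ?_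
      (Submodule.smul_mem _ _ ?_))
    · rw [neg_neg]
      exact hg.resProd_mem_Og_aux hr i (A.gr_le_wt k hk) ha _
    · have h := hg.resProd_mem_Og hs (A.gr_le_wt l hl) hb (A.resProd α (-i) a x)
        (n := 1) (m := 1 + i) (by omega)
      convert h using 4
      · push_cast; linear_combination hδ'
      · rw [hδ]; push_cast; ring
  · obtain ⟨N, hN⟩ := hsum.exists
    rw [hN]
    refine Submodule.sum_mem _ fun i _ => ?_
    rw [star_eq_zero hT (hwt i) (mt (exp_mul_exp_eq_one_iff hT).1 hrs) ?_ (hξ i), smul_zero]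
    · exact zero_mem _
    · have hprim := Complex.isPrimitiveRoot_exp _ hT.ne'
      rw [exp_eq_pow, exp_eq_pow, ← pow_add, pow_right_comm, hprim.pow_eq_one, one_pow]

/-- With p = -1 and exponents wt u, wt v, the iterate side is (u * v) * x. The i = 0 term in the
order Y(u)Y(v) is u * (v * x); all others have a pole of order at least 2 in their outer variable.
-/
theorem IsAutomorphism.star_assoc (u v x : V) :
    A.star g (A.star g u v) x - A.star g u (A.star g v x) ∈ A.Og g := by
  have hT := hg.ordT_pos hfin
  suffices h : u ∈ (A.Og g).comap
      (((A.star g).flip x).comp ((A.star g).flip v) - (A.star g).flip (A.star g v x)) from h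
  refine hg.homogeneous_induction hfin ?_ u
  rintro k r hr u ⟨hk, hu⟩
  simp only [Submodule.mem_comap, LinearMap.sub_apply, LinearMap.comp_apply, LinearMap.flip_apply]
  rcases Nat.eq_zero_or_pos r with rfl | hr0
  swap
  · simp [A.star_of_mem_pos hr0 hr hk hu]
  suffices h : v ∈ (A.Og g).comap
      (((A.star g).flip x).comp (A.star g u) - (A.star g u).comp ((A.star g).flip x)) from h
  refine hg.homogeneous_induction hfin ?_ v
  rintro l s hs v ⟨hl, hv⟩
  simp only [Submodule.mem_comap, LinearMap.sub_apply, LinearMap.comp_apply, LinearMap.flip_apply]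
  have hu1 := A.mem_eigStar_zero.1 hu
  have hwt := fun i : ℕ => A.mode_mem_wt (A.gr_le_wt k hk) (A.gr_le_wt l hl) (-1 + i)
  have hξ := fun i : ℕ => hg.twist_mode (A.gr_le_wt k hk) (A.gr_le_wt l hl) (ξ := 1)
    (by rw [hu1, one_smul]) (A.mem_eigStar.1 hv) (-1 + i)
  have hsum : ∀ᶠ N in atTop, A.star g (A.star g u v) x =
      ∑ i ∈ Finset.range N, Ring.choose ((k : ℂ) / 2) i • A.star g (A.Y u (-1 + i) v) x := by
    filter_upwards [A.eventually_resProd_eq_sum ((k : ℂ) / 2) 1 u v] with N hN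
    rw [star_of_mem_wt hT (A.gr_le_wt k hk) hu1 v, hN, map_sum, LinearMap.sum_apply]
    refine Finset.sum_congr rfl fun i _ => ?_
    rw [map_smul, LinearMap.smul_apply, sub_eq_neg_add]
  rcases Nat.eq_zero_or_pos s with rfl | hs0
  · have hv1 := A.mem_eigStar_zero.1 hv
    obtain ⟨N, ⟨hN, hJ⟩, hN0⟩ := ((hsum.and (eventually_resProd_assoc hk hl x (-1) 1 ((k : ℂ) / 2)
      ((l : ℂ) / 2))).and (eventually_ge_atTop 1)).exists
    have hN' : A.star g (A.star g u v) x = ∑ i ∈ Finset.range N, Ring.choose ((k : ℂ) / 2) i •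
          A.resProd ((k : ℂ) / 2 - i + (l : ℂ) / 2) 1 (A.Y u (-1 + i) v) x := by
      rw [hN]
      refine Finset.sum_congr rfl fun i _ => ?_
      rw [star_of_mem_wt hT (hwt i) (by rw [hξ i]; simp)]
      congr 4
      push_cast; ring
    have hB : ∀ i : ℕ, A.resProd ((l : ℂ) / 2) (1 - -1 + i) v
        (A.resProd ((k : ℂ) / 2) (-i) u x) ∈ A.Og g := by
      intro i
      have h := hg.resProd_mem_Og_aux hs i (A.gr_le_wt l hl) hv (A.resProd ((k : ℂ) / 2) (-i) u x)
      simpa [delta] using h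
    obtain ⟨N, rfl⟩ := Nat.exists_eq_add_of_le' hN0
    rw [hN', hJ, Finset.sum_range_succ', star_of_mem_wt hT (A.gr_le_wt k hk) hu1,
      star_of_mem_wt hT (A.gr_le_wt l hl) hv1, add_sub_assoc]
    refine Submodule.add_mem _ (Submodule.sum_mem _ fun i _ => Submodule.smul_mem _ _
      (Submodule.sub_mem _ ?_ (Submodule.smul_mem _ _ (hB _)))) ?_
    · have h := hg.resProd_mem_Og_aux hr i (A.gr_le_wt k hk) hu
        (A.resProd ((l : ℂ) / 2) (1 - (i + 1 : ℕ)) v x)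
      convert h using 4
      · simp [delta]
      · simp [delta]; ring
    · have h := hB 0
      simp only [pow_zero, Ring.choose_zero_right, mul_one, one_smul, Nat.cast_zero, sub_zero,
        add_zero, neg_neg] at h ⊢
      rw [sub_sub_cancel_left]
      exact neg_mem (Submodule.smul_mem _ _ h)
  · obtain ⟨N, hN⟩ := hsum.exists
    rw [hN, A.star_of_mem_pos hs0 hs hl hv, map_zero, sub_zero]
    refine Submodule.sum_mem _ fun i _ => ?_
    have hprim := Complex.isPrimitiveRoot_exp _ hT.ne'
    rw [star_eq_zero hT (hwt i) ?_ ?_ (hξ i), smul_zero]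
    · exact zero_mem _
    · rw [one_mul, exp_eq_pow]
      exact hprim.pow_ne_one_of_pos_of_lt hs0.ne' hs
    · rw [one_mul, exp_eq_pow, pow_right_comm, hprim.pow_eq_one, one_pow]

/-- Zhu's theorem for the twisted product `*_g`. -/
theorem IsAutomorphism.inducesAlgebra : A.InducesAlgebra g where
  star_mem_left u hu v := hg.star_mem_Og_left hfin hu v
  star_mem_right u v hv := hg.star_mem_Og_right hfin u hv
  assoc := hg.star_assoc hfin
  one_star v := by
    rw [star_of_mem_wt (hg.ordT_pos hfin) vac_mem_wt hg.twist_vac, A.resProd_eq_sum (N := 1)]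
    · simp [A.vac_mode]
    · intro i hi
      rw [A.vac_mode, if_neg (by omega)]; rfl
  star_one v := by
    suffices h : v ∈ (A.Og g).comap ((A.star g).flip A.vac - LinearMap.id) from h
    refine hg.homogeneous_induction hfin ?_ v
    rintro k r hr u ⟨hk, hu⟩
    simp only [Submodule.mem_comap, LinearMap.sub_apply, LinearMap.id_apply, LinearMap.flip_apply]
    rcases Nat.eq_zero_or_pos r with rfl | hr0
    · rw [star_of_mem_wt (hg.ordT_pos hfin) (A.gr_le_wt k hk) (A.mem_eigStar_zero.1 hu),
        A.resProd_eq_sum (N := 1)]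
      · simp [A.creation_limit]
      · intro i hi
        exact A.creation _ _ (by omega)
    · rw [A.star_of_mem_pos hr0 hr hk hu, zero_sub]
      exact neg_mem (eigStar_le_Og hr hr0.ne' ⟨hk, hu⟩)

end

/-! ### The action of A_g(V) on lowest weight vectors -/

section

variable {V : Type u} [AddCommGroup V] [Module ℂ V] {A : VertexOperatorSuperalgebra V}

/-- A homogeneous eigenvector of `gσ` is an eigenvector of `g`. -/
theorem IsAutomorphism.exists_mem_eig {g : V ≃ₗ[ℂ] V} (hfin : IsOfFinOrder g) {k r : ℕ} {u : V}
    (hu : u ∈ A.gr k ⊓ A.eigStar g r) :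
    u = 0 ∨ ∃ s < orderOf g, u ∈ eig g s ∧
      ∃ j : ℤ, (k : ℚ) / 2 + r / A.ordT g = (s : ℚ) / orderOf g + j := by
  by_cases h0 : u = 0
  · exact Or.inl h0
  refine Or.inr ?_
  have hT : 0 < orderOf g := orderOf_pos_iff.2 hfin
  have := NeZero.of_pos hT
  obtain ⟨hk, hr⟩ := hu
  rw [SetLike.mem_coe, mem_eigStar, LinearEquiv.mul_apply, A.sigma_of_mem hk, map_smul] at hr
  set ξ : ℂ := Complex.exp (2 * Real.pi * Complex.I * r / A.ordT g) with hξ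
  have hgu : g u = ((-1 : ℂ) ^ k * ξ) • u := by
    rw [mul_smul, ← hr, smul_smul, ← mul_pow]; simp
  have hpow : ∀ n : ℕ, (g ^ n) u = ((-1 : ℂ) ^ k * ξ) ^ n • u := by
    intro n
    induction n with
    | zero => simp
    | succ n ih => rw [pow_succ', LinearEquiv.mul_apply, ih, map_smul, hgu, smul_smul, pow_succ]
  have h1 : ((-1 : ℂ) ^ k * ξ) ^ orderOf g = 1 := by
    have h := hpow (orderOf g)
    rw [pow_orderOf_eq_one] at h
    refine smul_left_injective ℂ h0 ?_
    simpa using h.symm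
  obtain ⟨s, hs, hs'⟩ := (Complex.isPrimitiveRoot_exp _ hT.ne').eq_pow_of_pow_eq_one h1
  rw [← exp_eq_pow] at hs'
  refine ⟨s, hs, ?_, ?_⟩
  · rw [eig, Module.End.mem_eigenspace_iff, hs']
    exact hgu
  -- With (-1)^k = e^{πik}, equality of the exponentials means that k/2 + r/T and s/T₀ differ by an
  -- integer.
  · rw [← Complex.exp_pi_mul_I, ← Complex.exp_nat_mul, hξ, ← Complex.exp_add,
      Complex.exp_eq_exp_iff_exists_int] at hs'
    obtain ⟨n, hn⟩ := hs'
    refine ⟨-n, ?_⟩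
    have hpi : (2 * Real.pi * Complex.I : ℂ) ≠ 0 := Complex.two_pi_I_ne_zero
    have h2 : (k : ℂ) / 2 + r / A.ordT g = (s : ℂ) / orderOf g + (-n : ℤ) := by
      apply mul_left_cancel₀ hpi
      push_cast
      linear_combination -hn
    exact Rat.cast_injective (α := ℂ) (by push_cast at h2 ⊢; exact h2)

namespace WeakTwistedModule

variable {g : V ≃ₗ[ℂ] V} (M : WeakTwistedModule.{u, w} A g)

theorem o_of_mem_wt {q : ℚ} {a : V} (ha : a ∈ A.wt q) : M.o a = M.str.Y a (q - 1) := by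
  rcases A.mem_gr_of_mem_wt ha with rfl | ⟨k, hk, hk'⟩
  · simp
  · obtain rfl : q = (k : ℚ) / 2 := Rat.cast_injective (α := ℂ) (by push_cast; exact hk)
    exact M.o_of_mem hk'

variable {M}

theorem mode_eq_zero_of_mem_wt {x : M.carrier} (hx : x ∈ M.Omega) {q n : ℚ} {u : V}
    (hu : u ∈ A.wt q) (hn : q - 1 < n) : M.str.Y u n x = 0 := by
  rcases A.mem_gr_of_mem_wt hu with rfl | ⟨k, hk, hk'⟩
  · simp
  · obtain rfl : q = (k : ℚ) / 2 := Rat.cast_injective (α := ℂ) (by push_cast; exact hk)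
    exact hx k u hk' n hn

theorem mode_mem_wt_rat {k l : ℕ} {u v : V} (hu : u ∈ A.gr k) (hv : v ∈ A.gr l) (n : ℤ) :
    A.Y u n v ∈ A.wt (((k : ℚ) / 2 + l / 2 - n - 1 : ℚ) : ℂ) := by
  have h := A.mode_mem_wt (A.gr_le_wt k hu) (A.gr_le_wt l hv) n
  push_cast
  exact h

variable (M)

/-- `o(Res_z (1+z)^m z^p Y(u,z)v)` as an iterate side of the twisted Jacobi identity. -/
theorem o_resProd {k l : ℕ} {u v : V} (hu : u ∈ A.gr k) (hv : v ∈ A.gr l) (x : M.carrier) (p : ℤ)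
    (m n : ℚ) (hmn : m + n = (k : ℚ) / 2 + l / 2 - p - 2) :
    M.o (A.resProd (m : ℂ) (-p) u v) x =
      ∑ᶠ i : ℕ, (Ring.choose (m : ℂ) i) • M.str.Y (A.Y u (p + i) v) (m + n - i) x := by
  obtain ⟨N, hN⟩ := (A.eventually_mode_eq_zero u v (-p)).exists
  rw [A.resProd_eq_sum _ hN, finsum_eq_sum_of_support_subset (s := Finset.range N), map_sum,
    LinearMap.sum_apply]
  · refine Finset.sum_congr rfl fun i _ => ?_
    rw [map_smul, LinearMap.smul_apply, sub_neg_eq_add, add_comm (i : ℤ),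
      M.o_of_mem_wt (mode_mem_wt_rat hu hv (p + i))]
    rw [show (k : ℚ) / 2 + l / 2 - (p + i : ℤ) - 1 - 1 = m + n - i by rw [hmn]; push_cast; ring]
  · intro i hi
    by_contra hn
    apply hi
    have := hN i (by simpa using hn)
    rw [sub_neg_eq_add, add_comm] at this
    simp [this]

theorem o_vac : M.o A.vac = 1 := by
  rw [M.o_of_mem A.vac_mem]
  simp [M.str.vac_mode]

variable {M} (hg : A.IsAutomorphism g) (hfin : IsOfFinOrder g)
include hg hfin

/-- In the commutator formula (p = 0), u_n passes to x, which it kills, and each term (u_i a)_{n +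
wt a - 1 - i} has index above wt(u_i a) - 1 exactly because n > wt u - 1. -/
theorem o_mem_Omega (a : V) {x : M.carrier} (hx : x ∈ M.Omega) : M.o a x ∈ M.Omega := by
  suffices h : a ∈ M.Omega.comap (M.o.flip x) from h
  refine hg.homogeneous_induction hfin ?_ a
  rintro l _ _ a ⟨hl, _⟩
  rw [Submodule.mem_comap, LinearMap.flip_apply, M.o_of_mem hl]
  intro k u hk n hn
  set y := M.str.Y a ((l : ℚ) / 2 - 1) x with hy
  suffices h : A.gr k ≤
    LinearMap.ker ((LinearMap.applyₗ y).comp ((LinearMap.proj n).comp M.str.Y)) from h hk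
  refine hg.gr_le hfin ?_
  intro r hr u hu
  change M.str.Y u n y = 0
  rcases IsAutomorphism.exists_mem_eig hfin hu with rfl | ⟨s, hs, hus, -⟩
  · simp
  by_cases hj : ∃ j : ℤ, n = (s : ℚ) / orderOf g + j
  swap
  · rw [M.str.support s hs u hus n hj]; rfl
  obtain ⟨j, hj⟩ := hj
  have h := M.str.jacobi k l s hs u ⟨hu.1, hus⟩ a hl x 0 j n ((l : ℚ) / 2 - 1) hj
  rw [finsum_eq_single _ 0, finsum_eq_zero_of_forall_eq_zero] at h
  · have hu0 := hx k u hu.1 n hn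
    simpa [hu0] using h
  · intro i
    rw [mode_eq_zero_of_mem_wt hx (mode_mem_wt_rat hu.1 hl (0 + i)), smul_zero]
    push_cast
    linarith
  · intro i hi
    rw [Int.cast_zero, Ring.choose_zero_pos ℂ (Nat.pos_of_ne_zero hi), mul_zero, zero_smul]

theorem o_eq_zero_of_mem_Og {a : V} (ha : a ∈ A.Og g) {x : M.carrier} (hx : x ∈ M.Omega) :
    M.o a x = 0 := by
  suffices h : A.Og g ≤ LinearMap.ker (M.o.flip x) from h ha
  refine Submodule.span_le.2 ?_
  rintro _ ⟨k, r, hr, u, hu, v, rfl⟩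
  suffices h : v ∈ (LinearMap.ker (M.o.flip x)).comap
    (A.resProd ((k : ℂ) / 2 - 1 + delta r + (r : ℂ) / A.ordT g) (1 + delta r) u) from h
  refine hg.homogeneous_induction hfin ?_ v
  rintro l _ _ v ⟨hl, _⟩
  change M.o _ x = 0
  rcases IsAutomorphism.exists_mem_eig hfin hu with rfl | ⟨s, hs, hus, j, hj⟩
  · simp
  have hT : (0 : ℚ) < A.ordT g := by exact_mod_cast hg.ordT_pos hfin
  have hδ : (0 : ℚ) < delta r + (r : ℚ) / A.ordT g ∧
      (r : ℚ) / A.ordT g < 1 := by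
    refine ⟨?_, by rw [div_lt_one hT]; exact_mod_cast hr⟩
    rcases Nat.eq_zero_or_pos r with rfl | h0
    · simp [delta]
    · have : (0 : ℚ) < r := by exact_mod_cast h0
      positivity
  -- Here m > wt u - 1 because δ_r + r/T > 0, and n > wt v - 1 because r/T < 1. Both orders of modes
  -- therefore kill x, while the iterate side is o of the generator.
  have h := M.str.jacobi k l s hs u ⟨hu.1, hus⟩ v hl x (-(1 + delta r)) (j - 1 + delta r)
    ((k : ℚ) / 2 - 1 + delta r + (r : ℚ) / A.ordT g) ((l : ℚ) / 2 - (r : ℚ) / A.ordT g)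
    (by push_cast; linarith)
  rw [← M.o_resProd hu.1 hl x (-(1 + delta r)) _ _ (by push_cast; ring),
    finsum_eq_zero_of_forall_eq_zero] at h
  · rw [h]
    push_cast
    rw [neg_neg]
  · intro i
    have hi : (0 : ℚ) ≤ i := Nat.cast_nonneg i
    rw [hx k u hu.1 _ (by linarith), hx l v hl _ (by linarith)]
    simp

theorem o_star (u v : V) {x : M.carrier} (hx : x ∈ M.Omega) :
    M.o (A.star g u v) x = M.o u (M.o v x) := by
  have hT0 := hg.ordT_pos hfin
  have hT : (0 : ℚ) < A.ordT g := by exact_mod_cast hT0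
  suffices h : u ∈ LinearMap.ker
      ((M.o.flip x).comp ((A.star g).flip v) - M.o.flip (M.o v x)) from sub_eq_zero.1 h
  refine hg.homogeneous_induction hfin ?_ u
  intro k r hr u hu
  change M.o (A.star g u v) x - M.o u (M.o v x) = 0
  rw [sub_eq_zero]
  rcases IsAutomorphism.exists_mem_eig hfin hu with rfl | ⟨s, hs, hus, j, hj⟩
  · simp
  rcases Nat.eq_zero_or_pos r with rfl | hr0
  · suffices h : v ∈ LinearMap.ker ((M.o.flip x).comp (A.star g u) - (M.o u).comp (M.o.flip x))
      from sub_eq_zero.1 h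
    refine hg.homogeneous_induction hfin ?_ v
    rintro l _ _ v ⟨hl, _⟩
    change M.o (A.star g u v) x - M.o u (M.o v x) = 0
    rw [sub_eq_zero, star_of_mem_wt hT0 (A.gr_le_wt k hu.1) (A.mem_eigStar_zero.1 hu.2),
      M.o_of_mem hu.1, M.o_of_mem hl]
    -- With m = wt u and n = wt v - 1, every term with u acting first vanishes, and v_{n+i}x
    -- survives only for i = 0, leaving o(u)o(v)x.
    have h := M.str.jacobi k l s hs u ⟨hu.1, hus⟩ v hl x (-1) j ((k : ℚ) / 2) ((l : ℚ) / 2 - 1)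
      (by simpa using hj)
    rw [← M.o_resProd hu.1 hl x (-1) _ _ (by push_cast; ring), finsum_eq_single _ 0] at h
    · rw [hx k u hu.1 _ (by simp)] at h
      push_cast at h
      simp only [pow_zero, Ring.choose_zero_right, mul_one, one_smul, sub_zero,
        add_zero, map_zero, smul_zero, ← sub_eq_add_neg] at h
      exact h.symm
    · intro i hi
      have hi : (1 : ℚ) ≤ i := by exact_mod_cast Nat.one_le_iff_ne_zero.2 hi
      rw [hx k u hu.1 _ (by linarith), hx l v hl _ (by linarith)]
      simp
  · rw [A.star_of_mem_pos hr0 hr hu.1 hu.2, M.o_of_mem hu.1, M.str.support s hs u hus]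
    · simp
    · rintro ⟨j', hj'⟩
      -- If wt u - 1 were an admissible index, r/T would be an integer strictly between 0 and 1.
      have h1 : (r : ℚ) / A.ordT g = ((j - j' - 1 : ℤ) : ℚ) := by push_cast; linarith
      have h2 : (r : ℚ) / A.ordT g < 1 := by rw [div_lt_one hT]; exact_mod_cast hr
      have h3 : 0 < (r : ℚ) / A.ordT g := div_pos (by exact_mod_cast hr0) hT
      rw [h1] at h2 h3
      norm_cast at h2 h3
      omega

variable (M) (h : A.InducesAlgebra g)

/-- The representation of `A_g(V)` on `Ω(M)`. -/
def rep : Ag h →ₐ[ℂ] Module.End ℂ M.Omega :=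
  AlgHom.ofLinearMap
    ((A.Og g).liftQ
      { toFun := fun a => (M.o a).restrict fun _ hx => o_mem_Omega hg hfin a hx
        map_add' := fun a b => by ext x; simp
        map_smul' := fun c a => by ext x; simp }
      (fun a ha => LinearMap.ext fun x => Subtype.ext (o_eq_zero_of_mem_Og hg hfin ha x.2)))
    (LinearMap.ext fun x => Subtype.ext (LinearMap.congr_fun M.o_vac x.1))
    (fun a b => by
      obtain ⟨u, rfl⟩ := Ag.mk_surjective h a
      obtain ⟨v, rfl⟩ := Ag.mk_surjective h b
      exact LinearMap.ext fun x => Subtype.ext (o_star hg hfin u v x.2))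

theorem coe_rep_mk_apply (a : V) (x : M.Omega) :
    (M.rep hg hfin h (Ag.mk h a) x : M.carrier) = M.o a x := rfl

/-! ### Functoriality of Ω -/

omit hg hfin in
theorem Hom.map_mem_Omega {M N : WeakTwistedModule.{u, w} A g} (f : Hom M N) {x : M.carrier}
    (hx : x ∈ M.Omega) : f.toLin x ∈ N.Omega := fun k u hu n hn => by
  rw [← f.map_mode, hx k u hu n hn, map_zero]

omit hg hfin in
theorem Hom.map_o {M N : WeakTwistedModule.{u, w} A g} (f : Hom M N) (a : V) (x : M.carrier) :
    f.toLin (M.o a x) = N.o a (f.toLin x) := by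
  suffices h : f.toLin.comp (M.o.flip x) = N.o.flip (f.toLin x) from LinearMap.congr_fun h a
  refine A.hom_ext_gr fun k v hv => ?_
  simp only [LinearMap.comp_apply, LinearMap.flip_apply, M.o_of_mem hv, N.o_of_mem hv, f.map_mode]

/-- `Ω(M)` as an `A_g(V)`-module. -/
def omegaModule : ModuleCat.{w} (Ag h) :=
  letI := Module.compHom M.Omega (M.rep hg hfin h).toRingHom
  ModuleCat.of (Ag h) M.Omega

/-- The functor `M ↦ Ω(M)`. -/
def omegaFunctor : CategoryTheory.Functor (WeakTwistedModule.{u, w} A g) (ModuleCat.{w} (Ag h)) where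
  obj M := M.omegaModule hg hfin h
  map {M N} f :=
    letI := Module.compHom M.Omega (M.rep hg hfin h).toRingHom
    letI := Module.compHom N.Omega (N.rep hg hfin h).toRingHom
    ModuleCat.ofHom (X := M.Omega) (Y := N.Omega)
      { toFun := fun x => ⟨f.toLin x, f.map_mem_Omega x.2⟩
        map_add' := fun x y => Subtype.ext (map_add f.toLin x.1 y.1)
        map_smul' := fun a x => by
          obtain ⟨u, rfl⟩ := Ag.mk_surjective h a
          exact Subtype.ext (f.map_o u x.1) }
  map_id _ := rfl
  map_comp _ _ := rfl

end WeakTwistedModule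

end

end VertexOperatorSuperalgebra

end

theorem theorem5p1 {V : Type u} [AddCommGroup V] [Module ℂ V]
    (A : VertexOperatorSuperalgebra V) (g : V ≃ₗ[ℂ] V) (hg : A.IsAutomorphism g)
    (hfin : IsOfFinOrder g) :
    ∃ h : A.InducesAlgebra g,
      (∀ M : VertexOperatorSuperalgebra.WeakTwistedModule.{u, w} A g,
        ∃ ρ : VertexOperatorSuperalgebra.Ag h →ₐ[ℂ] Module.End ℂ M.Omega,
          ∀ (a : V) (x : M.Omega),
            (ρ (VertexOperatorSuperalgebra.Ag.mk h a) x : M.carrier) = M.o a x) ∧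
      ∃ (F : CategoryTheory.Functor (VertexOperatorSuperalgebra.WeakTwistedModule.{u, w} A g)
            (ModuleCat.{w} (VertexOperatorSuperalgebra.Ag h)))
        (e : ∀ M : VertexOperatorSuperalgebra.WeakTwistedModule.{u, w} A g, F.obj M ≃+ M.Omega),
        (∀ (M : VertexOperatorSuperalgebra.WeakTwistedModule.{u, w} A g) (a : V) (x : F.obj M),
          (e M (VertexOperatorSuperalgebra.Ag.mk h a • x) : M.carrier) = M.o a (e M x)) ∧
        (∀ (M N : VertexOperatorSuperalgebra.WeakTwistedModule.{u, w} A g) (f : M ⟶ N)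
          (x : F.obj M), (e N (F.map f x) : N.carrier) = f.toLin (e M x)) := by

  have h := hg.inducesAlgebra hfin
  -- The functor's value is Ω(M) itself with scalars acting through `rep`, so the comparison `e` is
  -- the identity.
  refine ⟨h, fun M => ⟨M.rep hg hfin h, M.coe_rep_mk_apply hg hfin h⟩,
    VertexOperatorSuperalgebra.WeakTwistedModule.omegaFunctor hg hfin h,
    fun M => AddEquiv.refl M.Omega, fun M a x => rfl, fun M N f x => rfl⟩
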